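/- **Setting.** There are three items with $A\succ C$, $B\succ C$ and $A,B$ incomparable. An instance is a joint distribution of (value, interest) on $[0,H]\times\{A,B,C\}$ with density $f_G(v)>0$; put $F_G(v)=\int_0^v f_G$ and $q_G=F_G(H)$. A buyer of type $(v,G)$ gets value $v$ from any item $G'\succeq G$ and $0$ from any other item. A direct mechanism awards item $G$ with probability $a_G(v)\in[0,1]$ to a buyer reporting $(v,G)$, awards nothing otherwise, and charges $p_G(v)$; it is feasible if it is truthful and individually rational. Write $u_G(v)=\int_0^v a_G$. The menu complexity is the number of distinct pairs $(G,q)$ such that $a_G(v)=q$ for some $v\in[0,H]$. A mechanism is optimal if it maximizes the expected revenue among feasible mechanisms. A feasible dual $(\lambda,\alpha)$ consists of absolutely continuous $\lambda_A,\lambda_B,\lambda_C\ge 0$ on $[0,H]$ with $\lambda_G(H)=0$ (each with a fixed representative $\lambda_G'$ of its derivative), and of finite (positive) measures $\alpha_{C,A},\alpha_{C,B}$ on $[0,H]$. Its virtual values are $$\Phi_G(v)=v-\frac{q_G-F_G(v)}{f_G(v)}+\frac{-\lambda_G'(v)+N_G(v)}{f_G(v)},$$ where $N_A(v)=-\alpha_{C,A}([v,H])$,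 $N_B(v)=-\alpha_{C,B}([v,H])$ and $N_C=-N_A-N_B$. It is optimal if it minimizes $\sum_G\int_0^H f_G\max\{0,\Phi_G\}$ among feasible duals. A mechanism and a dual satisfy complementary slackness if, for every $G$, $a_G=1$ almost everywhere on $\{\Phi_G>0\}$, $a_G=0$ almost everywhere on $\{\Phi_G<0\}$, $a_G'(v)=0$ whenever $\lambda_G(v)>0$, and $u_C=u_G$ holds $\alpha_{C,G}$-almost everywhere for $G\in\{A,B\}$. Let $\underline r_G=\inf\{v\in[0,H]:f_G(v)\Phi_G(v)\ge0\}$, $\bar r_G=\sup\{v\in[0,H]:f_G(v)\Phi_G(v)\le0\}$ and $\underline x_G=\sup\{v\in[0,x]:\lambda_G(v)=0\}$. For $M\ge1$, a *top chain of length $M$* consists of points $(x_1,A),(x_2,B),(x_3,A),\dots$ ($M$ terms, alternating between $A$ and $B$; write $G_i$ for the item of the $i$-th term) such that * $\Phi_{G_i}(x_i)=0$ and $\lambda_{G_i}(x_i)>0$ for all $i\le M$; * there is flow into both items at each point: $\alpha_{C,A}(\{x_i\})>0$ and $\alpha_{C,B}(\{x_i\})>0$ for all $i\le M$; * $\underline{x_i}_{G_i}<x_{i+1}<x_i$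 for all $i<M$, and $x_1>\bar r_B$; * the chain reaches down to the bottom of the zero regions, which end at different points: for $i=M$, and for $i=M-1$ if $M\ge 2$, $\underline{x_i}_{G_i}=\underline r_{G_i}$; and $\underline r_A\ne\underline r_B$. **Theorem.** (i) For every instance, every feasible mechanism that satisfies complementary slackness with a feasible dual containing a top chain of length $M$ has menu complexity at least $M$. (ii) For every $M\ge1$ there are an instance and a feasible and optimal dual for it that contains a top chain of length $M$; there is an optimal mechanism that satisfies complementary slackness with this dual; and every optimal mechanism of this instance has menu complexity at least $M$. Hence optimal single-minded mechanisms can have unbounded menu complexity. -/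

import Mathlib

open Set MeasureTheory

namespace SingleMinded

/-- The three items. -/
inductive Item where
  | A
  | B
  | C
  deriving DecidableEq

instance : Fintype Item where
  elems := {Item.A, Item.B, Item.C}
  complete G := by cases G <;> simp

/-- The minimal partial order: `A` and `B` both dominate `C`, and are incomparable.
`G ≤ G'` means that a buyer interested in `G` is satisfied by `G'`. -/
instance : PartialOrder Item where
  le G G' := G = G' ∨ G = Item.C
  le_refl G := Or.inl rfl
  le_trans G₁ G₂ G₃ h₁ h₂ := by
    rcases h₁ with rfl | rfl
    · exact h₂
    · exact Or.inr rfl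
  le_antisymm G₁ G₂ h₁ h₂ := by
    rcases h₁ with h | h
    · exact h
    · rcases h₂ with h' | h'
      · exact h'.symm
      · rw [h, h']

instance (G G' : Item) : Decidable (G ≤ G') :=
  inferInstanceAs (Decidable (G = G' ∨ G = Item.C))

noncomputable section

/-- A joint distribution of (value, interest) on `[0, H] × {A, B, C}`, given by its
strictly positive density: `f G v` is the density at `(v, G)`. -/
structure Instance where
  H : ℝ
  H_pos : 0 < H
  f : Item → ℝ → ℝ
  f_pos : ∀ G, ∀ v ∈ Icc 0 H, 0 < f G v
  f_int : ∀ G, IntervalIntegrable (f G) volume 0 H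
  f_mass : ∑ G, ∫ v in (0 : ℝ)..H, f G v = 1

namespace Instance

variable (I : Instance)

/-- `F_G(v)`, the probability that the interest is `G` and the value is at most `v`. -/
def F (G : Item) (v : ℝ) : ℝ := ∫ w in (0 : ℝ)..v, I.f G w

/-- `q_G`, the probability that the interest is `G`. -/
def q (G : Item) : ℝ := I.F G I.H

/-- Myerson's virtual value `φ_G` of the value conditioned on interest `G`, that is, of the
distribution function `F_G / q_G` and the density `f_G / q_G`. -/
def phi (G : Item) (v : ℝ) : ℝ := v - (I.q G - I.F G v) / I.f G v

end Instance

/-! ### Mechanisms -/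

/-- A direct mechanism: a buyer reporting `(v, G)` receives item `G` with probability `a G v`
(and nothing otherwise), and pays `p G v`. -/
structure Mechanism where
  a : Item → ℝ → ℝ
  p : Item → ℝ → ℝ

namespace Mechanism

variable (m : Mechanism) (I : Instance)

/-- Expected utility of the type `(v, G)` when it reports `(v', G')`. -/
def reportUtility (G : Item) (v : ℝ) (G' : Item) (v' : ℝ) : ℝ :=
  (if G ≤ G' then v * m.a G' v' else 0) - m.p G' v'

/-- The mechanism allocates with probabilities, is truthful, and is individually rational. -/
structure Feasible : Prop where
  prob : ∀ G, ∀ v ∈ Icc 0 I.H, m.a G v ∈ Icc (0 : ℝ) 1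
  truthful : ∀ G, ∀ v ∈ Icc 0 I.H, ∀ G', ∀ v' ∈ Icc 0 I.H,
    m.reportUtility G v G' v' ≤ m.reportUtility G v G v
  rational : ∀ G, ∀ v ∈ Icc 0 I.H, 0 ≤ m.reportUtility G v G v

/-- Expected revenue. -/
def revenue : ℝ := ∑ G, ∫ v in (0 : ℝ)..I.H, I.f G v * m.p G v

/-- Revenue-optimal among all feasible mechanisms. -/
def Optimal : Prop :=
  m.Feasible I ∧ ∀ m' : Mechanism, m'.Feasible I → m'.revenue I ≤ m.revenue I

/-- `u_G(v) = ∫₀ᵛ a_G`. -/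
def u (G : Item) (v : ℝ) : ℝ := ∫ w in (0 : ℝ)..v, m.a G w

/-- The number of distinct pairs `(G, q)` for which some `v` has `a_G(v) = q`. -/
def menuComplexity : ℕ∞ :=
  Set.encard {z : Item × ℝ | ∃ v ∈ Icc 0 I.H, m.a z.1 v = z.2}

end Mechanism

/-! ### Duals -/

/-- Dual variables: `lam G` is `λ_G`, the multiplier of the monotonicity constraint of `a_G`, and
`dlam G` is (a representative of) its derivative `λ'_G`; `alphaCA` and `alphaCB` are the
multipliers `α_{C,A}` and `α_{C,B}` of the constraints `u_C ≥ u_A` and `u_C ≥ u_B`. The latter are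
measures, so that flow may be sent at single points. -/
structure Dual where
  lam : Item → ℝ → ℝ
  dlam : Item → ℝ → ℝ
  alphaCA : Measure ℝ
  alphaCB : Measure ℝ

namespace Dual

variable (D : Dual) (I : Instance)

/-- Dual feasibility: each `λ_G` is nonnegative and absolutely continuous on `[0, H]` with
derivative `λ'_G` and `λ_G(H) = 0`; the flows are finite measures on `[0, H]`. -/
structure Feasible : Prop where
  dlam_int : ∀ G, IntervalIntegrable (D.dlam G) volume 0 I.H
  lam_eq : ∀ G, ∀ v ∈ Icc 0 I.H, D.lam G v = - ∫ w in v..I.H, D.dlam G w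
  lam_nonneg : ∀ G, ∀ v ∈ Icc 0 I.H, 0 ≤ D.lam G v
  finiteA : IsFiniteMeasure D.alphaCA
  finiteB : IsFiniteMeasure D.alphaCB
  suppA : D.alphaCA (Icc 0 I.H)ᶜ = 0
  suppB : D.alphaCB (Icc 0 I.H)ᶜ = 0

/-- Flow out of `G` minus flow into `G` at values at least `v`. -/
def netOut (G : Item) (v : ℝ) : ℝ :=
  match G with
  | Item.A => - D.alphaCA.real (Icc v I.H)
  | Item.B => - D.alphaCB.real (Icc v I.H)
  | Item.C => D.alphaCA.real (Icc v I.H) + D.alphaCB.real (Icc v I.H)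

/-- The virtual value `Φ_G^{λ,α}(v)`. -/
def Phi (G : Item) (v : ℝ) : ℝ :=
  I.phi G v + 1 / I.f G v * (- D.dlam G v + D.netOut I G v)

/-- The value of the Lagrangian relaxation induced by the dual,
`max_{a ∈ [0,1]} ∑_G ∫ f_G a_G Φ_G`. -/
def value : ℝ := ∑ G, ∫ v in (0 : ℝ)..I.H, I.f G v * max 0 (D.Phi I G v)

/-- Optimal dual: feasible, with the least Lagrangian value. -/
def Optimal : Prop :=
  D.Feasible I ∧ ∀ D' : Dual, D'.Feasible I → D.value I ≤ D'.value I

/-- Complementary slackness of a primal and a dual. -/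
structure CompSlack (m : Mechanism) : Prop where
  pos : ∀ G, ∀ᵐ v, v ∈ Icc 0 I.H → 0 < D.Phi I G v → m.a G v = 1
  neg : ∀ G, ∀ᵐ v, v ∈ Icc 0 I.H → D.Phi I G v < 0 → m.a G v = 0
  ironed : ∀ G, ∀ v ∈ Icc 0 I.H, 0 < D.lam G v → HasDerivWithinAt (m.a G) 0 (Icc 0 I.H) v
  flowA : ∀ᵐ v ∂D.alphaCA, m.u Item.C v = m.u Item.A v
  flowB : ∀ᵐ v ∂D.alphaCB, m.u Item.C v = m.u Item.B v

/-- Bottom end point of the zero region of `G`. -/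
def rLow (G : Item) : ℝ := sInf {v | v ∈ Icc 0 I.H ∧ 0 ≤ I.f G v * D.Phi I G v}

/-- Top end point of the zero region of `G`. -/
def rHigh (G : Item) : ℝ := sSup {v | v ∈ Icc 0 I.H ∧ I.f G v * D.Phi I G v ≤ 0}

/-- Bottom end point of the ironed interval containing `x` in `G`. -/
def ironBot (G : Item) (x : ℝ) : ℝ := sSup {v | 0 ≤ v ∧ v ≤ x ∧ D.lam G v = 0}

/-- There is (a point mass of) flow into `A` at `x`. -/
def FlowIntoA (x : ℝ) : Prop := 0 < D.alphaCA {x}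

/-- There is (a point mass of) flow into `B` at `x`. -/
def FlowIntoB (x : ℝ) : Prop := 0 < D.alphaCB {x}

/-- There is flow from `C` into `G` at `x`. -/
def FlowInto (G : Item) (x : ℝ) : Prop :=
  match G with
  | Item.A => D.FlowIntoA x
  | Item.B => D.FlowIntoB x
  | Item.C => False

end Dual

/-- The items along a chain: `A, B, A, B, …`. -/
def chainItem (i : ℕ) : Item := if Even i then Item.A else Item.B

/-- `(x 0, A), (x 1, B), (x 2, A), …` (the first `M` terms) is a chain. -/
structure IsChain (I : Instance) (D : Dual) (M : ℕ) (x : ℕ → ℝ) : Prop where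
  mem : ∀ i < M, x i ∈ Icc 0 I.H
  zero : ∀ i < M, D.Phi I (chainItem i) (x i) = 0
  flow : ∀ i < M, D.FlowInto (chainItem i) (x i)
  ironed : ∀ i < M, 0 < D.lam (chainItem i) (x i)
  step : ∀ i, i + 1 < M → D.ironBot (chainItem i) (x i) < x (i + 1) ∧ x (i + 1) < x i

/-- A chain that starts above the zero region of `B`. -/
structure IsTopChain (I : Instance) (D : Dual) (M : ℕ) (x : ℕ → ℝ) : Prop
    extends IsChain I D M x where
  length_pos : 0 < M
  top : D.rHigh I Item.B < x 0

/-- A top chain with flow into both items at each of its points, which reaches down to the bottom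
of the zero regions of the items (the lowest chain point of either item lies in the ironed interval
that starts at the bottom of the zero region), these bottoms being different for `A` and `B`. -/
structure IsSpanningTopChain (I : Instance) (D : Dual) (M : ℕ) (x : ℕ → ℝ) : Prop
    extends IsTopChain I D M x where
  both : ∀ i < M, D.FlowIntoA (x i) ∧ D.FlowIntoB (x i)
  bottom : ∀ i < M, M ≤ i + 2 → D.ironBot (chainItem i) (x i) = D.rLow I (chainItem i)
  distinct : D.rLow I Item.A ≠ D.rLow I Item.B

end

end SingleMinded

/-!
**Chains.** Let a mechanism satisfy complementary slackness with a dual that contains a spanning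
top chain `x 0 > x 1 > …`, and let `c i` be the allocation of the `i`-th chain item at `x i`. Flow
into both items makes `u_A = u_B = u_C` at all chain points, and the allocation of the `i`-th item
is constant from `x i` down past `x (i + 1)`. Hence between `x (i + 1)` and `x i` the other item
starts at `c (i + 1)`, ends at `c (i - 1)` and has average `c i`, so that `c (i + 1) < c i` forces
`c i < c (i - 1)` (`IsSpanningTopChain.a_lt_of_lt`). At the bottom both items are zero below their
zero regions and constant above; as these regions start at different points while `u_A = u_B` at
the lowest chain point, the last two `c i` differ unless both vanish. Vanishing would propagate up
to `x 0`, where `u_A = u_B > 0` because `B` is always served above its zero region. So the `c i`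
strictly decrease, and the pairs `(item, c i)` are distinct menu entries
(`IsSpanningTopChain.le_menuComplexity`).

**Duality.** For a feasible mechanism and a feasible dual, the value of the dual exceeds the revenue
by a sum of nonnegative terms, one for each complementary slackness condition
(`Dual.Feasible.value_sub_revenue`, an application of Fubini's theorem). For the ironing terms
`∫ a_G (-λ_G')` the layer cake formula gives `∫₀¹ λ_G (s t) dt`, where `s t` is the value at which
`a_G` crosses the level `t`; this vanishes precisely when `a_G` does not move where `λ_G > 0`. Hence
complementary slackness implies optimality of both sides and is then shared by all optimal
mechanisms (`Dual.Feasible.optimal_of_compSlack`).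

**The instance.** Chain points `2M, 2M - 1, …, M + 1` carry equal point masses of flow into `A` and
`B`; the ironing multipliers are `1 - cos (π (v - r))` on the zero regions of `A` and `B`, whose
bottoms `r` are `M - 1/2` and `M + 1/2`. Since `f_G Φ_G = -R_G' - λ_G' + N_G` for the revenue curve
`R_G(v) = v (q_G - F_G(v))`, prescribing `R_G' = N_G - λ_G'` on a zero region makes the virtual
value vanish there, and `R_G` determines the density; a large decrease of `R_G` above the zero
region makes the density positive. The mechanism has `A` and `B` climb stairs whose steps, of length
`2`, are the ironed intervals; `u_A` and `u_B` cross at the chain points, and `u_C` is their maximum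
(`Ladder.compSlack`).
-/

namespace SingleMinded

/-! ### Integrals of monotone functions -/

/-- Integration by parts against a measure, by Fubini's theorem. With `k = 1` and `μ` a flow it
turns `∫ u_G dα` into `∫ a_G(w) α([w, H]) dw`; with `μ` Lebesgue measure and `k` a density it turns
`∫ f_G u_G` into `∫ a_G (q_G - F_G)`. -/
theorem integral_mul_primitive {H : ℝ} {h k : ℝ → ℝ} {μ : Measure ℝ} [SFinite μ]
    (hh : IntervalIntegrable h volume 0 H) (hH : (0 : ℝ) ≤ H)
    (hk : IntegrableOn k (Icc 0 H) μ) :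
    ∫ v in Icc 0 H, k v * (∫ w in (0 : ℝ)..v, h w) ∂μ =
      ∫ w in (0 : ℝ)..H, h w * ∫ v in Icc w H, k v ∂μ := by
  have hh' : Integrable h (volume.restrict (Ioc 0 H)) := 
    (intervalIntegrable_iff_integrableOn_Ioc_of_le hH).1 hh
  have hS : MeasurableSet {z : ℝ × ℝ | z.2 ≤ z.1} :=
    measurableSet_le (f := fun z : ℝ × ℝ => z.2) (g := fun z => z.1) measurable_snd measurable_fst
  have hint : Integrable (Function.uncurry fun v w => {z : ℝ × ℝ | z.2 ≤ z.1}.indicator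
      (fun z => k z.1 * h z.2) (v, w)) ((μ.restrict (Icc 0 H)).prod (volume.restrict (Ioc 0 H))) :=
    (Integrable.mul_prod hk hh').indicator hS
  have h1 : ∫ v in Icc 0 H, k v * (∫ w in (0 : ℝ)..v, h w) ∂μ =
      ∫ v in Icc 0 H, (∫ w in Ioc 0 H, {z : ℝ × ℝ | z.2 ≤ z.1}.indicator
        (fun z => k z.1 * h z.2) (v, w)) ∂μ := by
    refine setIntegral_congr_fun measurableSet_Icc fun v hv => ?_
    have : (fun w => {z : ℝ × ℝ | z.2 ≤ z.1}.indicator (fun z => k z.1 * h z.2) (v, w)) =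
        (Iic v).indicator fun w => k v * h w := by
      ext w; simp [indicator]
    simp only [this]
    rw [setIntegral_indicator measurableSet_Iic, intervalIntegral.integral_of_le hv.1,
      ← integral_const_mul]
    congr 2
    rw [Ioc_inter_Iic, min_eq_right hv.2]
  have h2 : ∫ w in (0 : ℝ)..H, h w * ∫ v in Icc w H, k v ∂μ =
      ∫ w in Ioc 0 H, (∫ v in Icc 0 H, {z : ℝ × ℝ | z.2 ≤ z.1}.indicator
        (fun z => k z.1 * h z.2) (v, w) ∂μ) := by
    rw [intervalIntegral.integral_of_le hH]
    refine setIntegral_congr_fun measurableSet_Ioc fun w hw => ?_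
    have : (fun v => {z : ℝ × ℝ | z.2 ≤ z.1}.indicator (fun z => k z.1 * h z.2) (v, w)) =
        (Ici w).indicator fun v => h w * k v := by
      ext v; simp [indicator, mul_comm]
    simp only [this]
    rw [setIntegral_indicator measurableSet_Ici, ← integral_const_mul]
    congr 2
    ext v
    simp only [mem_Icc, mem_inter_iff, mem_Ici]
    constructor
    · rintro ⟨h1, h2⟩; exact ⟨⟨by linarith [hw.1], h2⟩, h1⟩
    · rintro ⟨⟨_, h2⟩, h1⟩; exact ⟨h1, h2⟩
  rw [h1, h2]
  exact integral_integral_swap hint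

/-- A monotone function crosses the level `t` at a point `s`; if it stays at most `t` then `s = H`. -/
theorem exists_threshold {H : ℝ} {a : ℝ → ℝ} (hH : 0 ≤ H) (ha : MonotoneOn a (Icc 0 H)) (t : ℝ) :
    ∃ s ∈ Icc 0 H, (∀ v ∈ Icc 0 H, v < s → a v ≤ t) ∧ (∀ v ∈ Icc 0 H, s < v → t < a v) := by
  have hne : (({v | v ∈ Icc 0 H ∧ t < a v} ∪ {H}) : Set ℝ).Nonempty := ⟨H, Or.inr rfl⟩
  have hbd : BddBelow (({v | v ∈ Icc 0 H ∧ t < a v} ∪ {H}) : Set ℝ) := by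
    refine ⟨0, ?_⟩
    rintro v (hv | rfl)
    exacts [hv.1.1, hH]
  refine ⟨sInf ({v | v ∈ Icc 0 H ∧ t < a v} ∪ {H}), ⟨?_, csInf_le hbd (Or.inr rfl)⟩, ?_, ?_⟩
  · refine le_csInf hne ?_
    rintro v (hv | rfl)
    exacts [hv.1.1, hH]
  · intro v hv hlt
    by_contra! hc
    exact absurd (csInf_le hbd (Or.inl ⟨hv, hc⟩)) (not_le.2 hlt)
  · intro v hv hlt
    obtain ⟨w, hw | rfl, hwv⟩ := exists_lt_of_csInf_lt hne hlt
    · exact hw.2.trans_le (ha hw.1 hv hwv.le)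
    · exact absurd hv.2 (not_le.2 hwv)

/-- The layer cake formula for a monotone weight `a`: up to null sets, the level sets `{a > t}` are
the intervals `[s t, H]`. -/
theorem exists_layer_cake {H : ℝ} {a l : ℝ → ℝ} (hH : 0 ≤ H) (ha : MonotoneOn a (Icc 0 H))
    (ha' : ∀ v ∈ Icc 0 H, a v ∈ Icc (0 : ℝ) 1) (hl : IntervalIntegrable l volume 0 H) :
    ∃ s : ℝ → ℝ, (∀ t, s t ∈ Icc 0 H) ∧ (∀ t, ∀ v ∈ Icc 0 H, v < s t → a v ≤ t) ∧
      (∀ t, ∀ v ∈ Icc 0 H, s t < v → t < a v) ∧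
      IntegrableOn (fun t => ∫ v in s t..H, l v) (Ioc 0 1) ∧
      ∫ v in (0 : ℝ)..H, a v * l v = ∫ t in Ioc (0 : ℝ) 1, ∫ v in s t..H, l v := by
  choose s hs hs1 hs2 using exists_threshold hH ha
  refine ⟨s, hs, hs1, hs2, ?_⟩
  have hl' : Integrable l (volume.restrict (Ioc 0 H)) := 
    (intervalIntegrable_iff_integrableOn_Ioc_of_le hH).1 hl
  obtain ⟨b, hb, hab⟩ := ha.exists_monotone_extension
    ⟨0, by rintro _ ⟨v, hv, rfl⟩; exact (ha' v hv).1⟩ ⟨1, by rintro _ ⟨v, hv, rfl⟩; exact (ha' v hv).2⟩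
  have hS : MeasurableSet {z : ℝ × ℝ | z.2 < b z.1} :=
    measurableSet_lt measurable_snd (hb.measurable.comp measurable_fst)
  have hint : Integrable (Function.uncurry fun v t => {z : ℝ × ℝ | z.2 < b z.1}.indicator
      (fun z => l z.1 * 1) (v, t)) ((volume.restrict (Ioc 0 H)).prod (volume.restrict (Ioc 0 1))) :=
    (Integrable.mul_prod hl' (integrable_const 1)).indicator hS
  have h1 : ∫ v in (0 : ℝ)..H, a v * l v =
      ∫ v in Ioc 0 H, (∫ t in Ioc (0 : ℝ) 1, {z : ℝ × ℝ | z.2 < b z.1}.indicator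
        (fun z => l z.1 * 1) (v, t)) := by
    rw [intervalIntegral.integral_of_le hH]
    refine setIntegral_congr_fun measurableSet_Ioc fun v hv => ?_
    have hv' := Ioc_subset_Icc_self hv
    have : (fun t => {z : ℝ × ℝ | z.2 < b z.1}.indicator (fun z => l z.1 * 1) (v, t)) =
        (Iio (a v)).indicator fun t => l v := by
      ext w; simp [indicator, hab hv']
    simp only [this]
    rw [setIntegral_indicator measurableSet_Iio]
    have h3 : ∫ t in Ioc (0 : ℝ) 1 ∩ Iio (a v), l v = ∫ t in Ioc 0 (a v), l v := by
      refine setIntegral_congr_set ?_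
      have : (Ioc (0 : ℝ) 1 ∩ Iio (a v) : Set ℝ) = Ioo 0 (a v) := by
        ext t
        simp only [mem_inter_iff, mem_Ioc, mem_Iio, mem_Ioo]
        have := (ha' v hv').2
        constructor
        · rintro ⟨⟨h1, _⟩, h2⟩; exact ⟨h1, h2⟩
        · rintro ⟨h1, h2⟩; exact ⟨⟨h1, by linarith⟩, h2⟩
      rw [this]
      exact Ioo_ae_eq_Ioc
    rw [h3, setIntegral_const, measureReal_def, Real.volume_Ioc, sub_zero,
      ENNReal.toReal_ofReal (ha' v hv').1, smul_eq_mul]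
  have h2 : ∀ t, ∫ v in s t..H, l v = (∫ v in Ioc 0 H, {z : ℝ × ℝ | z.2 < b z.1}.indicator
        (fun z => l z.1 * 1) (v, t)) := by
    intro t
    rw [intervalIntegral.integral_of_le (hs t).2]
    have : (fun v => {z : ℝ × ℝ | z.2 < b z.1}.indicator (fun z => l z.1 * 1) (v, t)) =
        {v | t < b v}.indicator l := by
      ext v; simp [indicator]
    rw [this, setIntegral_indicator (measurableSet_lt measurable_const hb.measurable)]
    refine setIntegral_congr_set ?_
    rw [ae_eq_set]
    constructor
    · refine measure_mono_null (t := ∅) ?_ measure_empty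
      rintro v ⟨⟨hv1, hv2⟩, hv3⟩
      refine hv3 ⟨⟨(hs t).1.trans_lt hv1, hv2⟩, ?_⟩
      have hv' : v ∈ Icc 0 H := ⟨(hs t).1.trans hv1.le, hv2⟩
      simpa [← hab hv'] using hs2 t v hv' hv1
    · refine measure_mono_null (t := {s t}) ?_ (measure_singleton _)
      rintro v ⟨⟨⟨hv1, hv2⟩, hv3⟩, hv4⟩
      have hv' : v ∈ Icc 0 H := ⟨hv1.le, hv2⟩
      rcases lt_trichotomy v (s t) with h | h | h
      · have := hs1 t v hv' h
        have hv3' : t < b v := hv3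
        rw [← hab hv'] at hv3'
        linarith
      · exact h
      · exact absurd ⟨h, hv2⟩ hv4
  simp only [h1, h2]
  exact ⟨hint.integral_prod_right, integral_integral_swap hint⟩

theorem monotoneOn_intervalIntegrable {H : ℝ} {a : ℝ → ℝ} (ha : MonotoneOn a (Icc 0 H)) {p q : ℝ}
    (hp : p ∈ Icc 0 H) (hq : q ∈ Icc 0 H) : IntervalIntegrable a volume p q :=
  (ha.mono (by
    intro v hv
    rcases le_total p q with h | h
    · rw [uIcc_of_le h] at hv; exact ⟨hp.1.trans hv.1, hv.2.trans hq.2⟩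
    · rw [uIcc_of_ge h] at hv; exact ⟨hq.1.trans hv.1, hv.2.trans hp.2⟩)).intervalIntegrable

/-- A function whose increments are dominated by those of `a` times the step is constant. -/
theorem eq_of_abs_sub_le_mul {H : ℝ} {a d : ℝ → ℝ}
    (h : ∀ x ∈ Icc 0 H, ∀ y ∈ Icc 0 H, x ≤ y → |d y - d x| ≤ (y - x) * (a y - a x)) {v : ℝ}
    (hv : v ∈ Icc 0 H) : d v = d 0 := by
  have key : ∀ n : ℕ, 0 < n → |d v - d 0| ≤ v / n * (a v - a 0) := by
    intro n hn
    have hn' : (0 : ℝ) < n := by exact_mod_cast hn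
    have hmem : ∀ i ≤ n, v * (i / n : ℝ) ∈ Icc 0 H := by
      intro i hi
      have h1 : (i / n : ℝ) ≤ 1 := by
        rw [div_le_one hn']; exact_mod_cast hi
      have h0 : (0 : ℝ) ≤ i / n := by positivity
      exact ⟨mul_nonneg hv.1 h0, (mul_le_of_le_one_right hv.1 h1).trans hv.2⟩
    have h1 : ∀ m ≤ n, |d (v * (m / n : ℝ)) - d 0| ≤ v / n * (a (v * (m / n : ℝ)) - a 0) := by
      intro m
      induction m with
      | zero => intro _; simp
      | succ m ih =>
        intro hm
        have e : v * ((m + 1 : ℕ) / n : ℝ) - v * (m / n : ℝ) = v / n := by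
          push_cast; field_simp; ring
        have hle : v * (m / n : ℝ) ≤ v * ((m + 1 : ℕ) / n : ℝ) := by
          have : 0 ≤ v / n := div_nonneg hv.1 hn'.le
          linarith
        have h2 := h _ (hmem m (by omega)) _ (hmem (m + 1) hm) hle
        have h3 := ih (by omega)
        rw [e] at h2
        have h4 := abs_add_le (d (v * ((m + 1 : ℕ) / n : ℝ)) - d (v * (m / n : ℝ)))
          (d (v * (m / n : ℝ)) - d 0)
        rw [sub_add_sub_cancel] at h4
        calc _ ≤ _ := h4
          _ ≤ _ := add_le_add h2 h3
          _ = _ := by ring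
    have := h1 n le_rfl
    rwa [div_self hn'.ne', mul_one] at this
  by_contra hne
  have hpos : 0 < |d v - d 0| := abs_pos.2 (sub_ne_zero.2 hne)
  obtain ⟨n, hn⟩ := exists_nat_gt (v * (a v - a 0) / |d v - d 0|)
  have h1 := key (n + 1) (by omega)
  rw [div_lt_iff₀ hpos] at hn
  have hn' : (0 : ℝ) < (n + 1 : ℕ) := by positivity
  have h2 : |d v - d 0| * (n + 1 : ℕ) ≤ v * (a v - a 0) := by
    have := mul_le_mul_of_nonneg_right h1 hn'.le
    calc _ ≤ _ := this
      _ = _ := by field_simp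
  push_cast at h2
  nlinarith

/-! ### Feasible mechanisms and the duality gap -/

theorem sum_item (g : Item → ℝ) : ∑ G, g G = g Item.A + g Item.B + g Item.C := by
  have : (Finset.univ : Finset Item) = {Item.A, Item.B, Item.C} := rfl
  rw [this]; simp [add_assoc]

/-- A monotone function on a compact interval is a bounded multiplier. -/
theorem intervalIntegrable_mul_monotoneOn {H : ℝ} {g a : ℝ → ℝ} (hH : 0 ≤ H)
    (hg : IntervalIntegrable g volume 0 H) (ha : MonotoneOn a (Icc 0 H)) :
    IntervalIntegrable (fun v => a v * g v) volume 0 H := by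
  rw [intervalIntegrable_iff_integrableOn_Ioc_of_le hH] at hg ⊢
  have hm : AEStronglyMeasurable a (volume.restrict (Ioc 0 H)) :=
    ((intervalIntegrable_iff_integrableOn_Ioc_of_le hH).1
      (monotoneOn_intervalIntegrable ha (left_mem_Icc.2 hH) (right_mem_Icc.2 hH))).aestronglyMeasurable
  refine Integrable.bdd_mul (c := max |a 0| |a H|) hg hm ?_
  refine (ae_restrict_mem measurableSet_Ioc).mono fun v hv => ?_
  have hv' := Ioc_subset_Icc_self hv
  have h1 := ha (left_mem_Icc.2 hH) hv' hv'.1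
  have h2 := ha hv' (right_mem_Icc.2 hH) hv'.2
  rw [Real.norm_eq_abs, abs_le]
  constructor
  · have := neg_abs_le (a 0); have := le_max_left |a 0| |a H|; linarith
  · have := le_abs_self (a H); have := le_max_right |a 0| |a H|; linarith

theorem integral_mem_Icc_of_monotoneOn {a : ℝ → ℝ} {H x y : ℝ} (ha : MonotoneOn a (Icc 0 H)) (hx : x ∈ Icc 0 H)
    (hy : y ∈ Icc 0 H) (hxy : x ≤ y) :
    ∫ w in x..y, a w ∈ Icc ((y - x) * a x) ((y - x) * a y) := by
  have hi := monotoneOn_intervalIntegrable ha hx hy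
  have hsub : ∀ w ∈ Icc x y, w ∈ Icc 0 H := fun w hw => ⟨hx.1.trans hw.1, hw.2.trans hy.2⟩
  constructor
  · have := intervalIntegral.integral_mono_on (f := fun _ => a x) hxy
      intervalIntegrable_const hi (fun w hw => ha hx (hsub w hw) hw.1)
    simpa using this
  · have := intervalIntegral.integral_mono_on (g := fun _ => a y) hxy hi
      intervalIntegrable_const (fun w hw => ha (hsub w hw) hy hw.2)
    simpa using this

namespace Mechanism

variable {m : Mechanism} {I : Instance}

theorem reportUtility_self (m : Mechanism) (G : Item) (v v' : ℝ) :
    m.reportUtility G v G v' = v * m.a G v' - m.p G v' := by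
  simp [reportUtility]

theorem Feasible.monotoneOn (h : m.Feasible I) (G : Item) : MonotoneOn (m.a G) (Icc 0 I.H) := by
  intro x hx y hy hxy
  have h1 := h.truthful G x hx G y hy
  have h2 := h.truthful G y hy G x hx
  simp only [reportUtility_self] at h1 h2
  rcases hxy.eq_or_lt with rfl | hlt
  · exact le_rfl
  · by_contra! hc
    nlinarith

theorem u_sub_u (ha : MonotoneOn (m.a G) (Icc 0 I.H)) {x y : ℝ} (hx : x ∈ Icc 0 I.H)
    (hy : y ∈ Icc 0 I.H) : m.u G y - m.u G x = ∫ w in x..y, m.a G w := by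
  have h0 : (0 : ℝ) ∈ Icc 0 I.H := left_mem_Icc.2 I.H_pos.le
  have := intervalIntegral.integral_add_adjacent_intervals
    (monotoneOn_intervalIntegrable ha h0 hx) (monotoneOn_intervalIntegrable ha hx hy)
  simp only [u]
  linarith

theorem Feasible.p_zero (h : m.Feasible I) (G G' : Item) : m.p G 0 = m.p G' 0 := by
  have h0 : (0 : ℝ) ∈ Icc 0 I.H := left_mem_Icc.2 I.H_pos.le
  have h1 := h.truthful G 0 h0 G' 0 h0
  have h2 := h.truthful G' 0 h0 G 0 h0
  simp only [reportUtility, zero_mul, ite_self] at h1 h2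
  linarith

/-- The envelope formula: utility is the utility at value zero plus `u_G`. -/
theorem Feasible.utility_eq (h : m.Feasible I) (G : Item) {v : ℝ} (hv : v ∈ Icc 0 I.H) :
    v * m.a G v - m.p G v = -m.p Item.C 0 + m.u G v := by
  have ha := h.monotoneOn G
  have key := eq_of_abs_sub_le_mul (H := I.H) (a := m.a G)
    (d := fun v => v * m.a G v - m.p G v - m.u G v) ?_ hv
  · have h0 := h.p_zero G Item.C
    have h1 : m.u G 0 = 0 := by simp [u]
    simp only [zero_mul, h1] at key
    linarith
  · intro x hx y hy hxy
    have h1 := h.truthful G x hx G y hy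
    have h2 := h.truthful G y hy G x hx
    simp only [reportUtility_self] at h1 h2
    have h3 := integral_mem_Icc_of_monotoneOn ha hx hy hxy
    have h4 := u_sub_u ha hx hy
    rw [← h4] at h3
    rw [abs_le]
    constructor <;> nlinarith [h3.1, h3.2]

theorem Feasible.p_zero_nonpos (h : m.Feasible I) : m.p Item.C 0 ≤ 0 := by
  have h0 : (0 : ℝ) ∈ Icc 0 I.H := left_mem_Icc.2 I.H_pos.le
  have := h.rational Item.C 0 h0
  rw [reportUtility_self] at this
  linarith

theorem Feasible.u_le (h : m.Feasible I) (G : Item) {v : ℝ} (hv : v ∈ Icc 0 I.H) :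
    m.u G v ≤ m.u Item.C v := by
  have h1 := h.truthful Item.C v hv G v hv
  rw [reportUtility_self, h.utility_eq Item.C hv, reportUtility,
    if_pos (show Item.C ≤ G from Or.inr rfl), h.utility_eq G hv] at h1
  linarith

/-- Monotone allocations ordered by `u_A, u_B ≤ u_C`, with the payments that give type `(v, G)` the
utility `u_G(v)`, form a feasible mechanism. -/
theorem feasible_of_monotoneOn (hprob : ∀ G, ∀ v ∈ Icc 0 I.H, m.a G v ∈ Icc (0 : ℝ) 1)
    (hmono : ∀ G, MonotoneOn (m.a G) (Icc 0 I.H))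
    (hu : ∀ G, ∀ v ∈ Icc 0 I.H, m.u G v ≤ m.u Item.C v)
    (hp : ∀ G v, m.p G v = v * m.a G v - m.u G v) : m.Feasible I := by
  have h0 : (0 : ℝ) ∈ Icc 0 I.H := left_mem_Icc.2 I.H_pos.le
  have hnn : ∀ G, ∀ v ∈ Icc 0 I.H, 0 ≤ m.u G v := fun G v hv =>
    intervalIntegral.integral_nonneg hv.1 fun w hw => (hprob G w ⟨hw.1, hw.2.trans hv.2⟩).1
  have hle : ∀ G, ∀ v ∈ Icc 0 I.H, m.u G v ≤ v * m.a G v := by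
    intro G v hv
    have h1 := (integral_mem_Icc_of_monotoneOn (hmono G) h0 hv hv.1).2
    rw [sub_zero] at h1
    exact h1
  have hG : ∀ G, ∀ x ∈ Icc 0 I.H, ∀ y ∈ Icc 0 I.H,
      x * m.a G y - (y * m.a G y - m.u G y) ≤ m.u G x := by
    intro G x hx y hy
    rcases le_total x y with hxy | hxy
    · have h1 := (integral_mem_Icc_of_monotoneOn (hmono G) hx hy hxy).2
      rw [← u_sub_u (hmono G) hx hy] at h1
      linarith
    · have h1 := (integral_mem_Icc_of_monotoneOn (hmono G) hy hx hxy).1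
      rw [← u_sub_u (hmono G) hy hx] at h1
      linarith
  refine ⟨hprob, ?_, ?_⟩
  · intro G x hx G' y hy
    rw [reportUtility_self, reportUtility, hp, hp, sub_sub_cancel]
    split_ifs with hGG
    · rcases hGG with rfl | rfl
      · exact hG _ x hx y hy
      · exact (hG G' x hx y hy).trans (hu G' x hx)
    · have := hle G' y hy
      have := hnn G x hx
      linarith
  · intro G x hx
    rw [reportUtility_self, hp, sub_sub_cancel]
    exact hnn G x hx

end Mechanism

namespace Dual

variable {D : Dual} {I : Instance}

theorem f_mul_Phi (D : Dual) (G : Item) {v : ℝ} (hv : v ∈ Icc 0 I.H) :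
    I.f G v * D.Phi I G v =
      I.f G v * v - (I.q G - I.F G v) - D.dlam G v + D.netOut I G v := by
  have := (I.f_pos G v hv).ne'
  simp only [Phi, Instance.phi]
  field_simp
  ring

theorem tail_eq (I : Instance) (G : Item) {v : ℝ} (hv : v ∈ Icc 0 I.H) :
    I.q G - I.F G v = ∫ w in v..I.H, I.f G w := by
  have h1 : IntervalIntegrable (I.f G) volume 0 v :=
    (I.f_int G).mono_set (uIcc_subset_uIcc_left (by rw [uIcc_of_le I.H_pos.le]; exact hv))
  have h2 : IntervalIntegrable (I.f G) volume v I.H :=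
    (I.f_int G).mono_set (uIcc_subset_uIcc_right (by rw [uIcc_of_le I.H_pos.le]; exact hv))
  have := intervalIntegral.integral_add_adjacent_intervals h1 h2
  simp only [Instance.q, Instance.F]
  linarith

theorem antitone_real_Icc (μ : Measure ℝ) [IsFiniteMeasure μ] (H : ℝ) :
    Antitone fun v => μ.real (Icc v H) := fun _ _ h =>
  measureReal_mono (Icc_subset_Icc_left h)

theorem Feasible.netOut_int (hD : D.Feasible I) (G : Item) :
    IntervalIntegrable (D.netOut I G) volume 0 I.H := by
  have := hD.finiteA
  have := hD.finiteB
  have hA : IntervalIntegrable (fun v => D.alphaCA.real (Icc v I.H)) volume 0 I.H :=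
    (antitone_real_Icc D.alphaCA I.H).intervalIntegrable
  have hB : IntervalIntegrable (fun v => D.alphaCB.real (Icc v I.H)) volume 0 I.H :=
    (antitone_real_Icc D.alphaCB I.H).intervalIntegrable
  cases G
  exacts [hA.neg, hB.neg, hA.add hB]

theorem tail_int (I : Instance) (G : Item) :
    IntervalIntegrable (fun v => I.q G - I.F G v) volume 0 I.H := by
  refine ContinuousOn.intervalIntegrable (continuousOn_const.sub ?_)
  exact intervalIntegral.continuousOn_primitive_interval'  (I.f_int G) left_mem_uIcc

theorem Feasible.f_mul_Phi_int (hD : D.Feasible I) (G : Item) :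
    IntervalIntegrable (fun v => I.f G v * D.Phi I G v) volume 0 I.H := by
  have h1 : IntervalIntegrable (fun v => I.f G v * v - (I.q G - I.F G v) - D.dlam G v +
      D.netOut I G v) volume 0 I.H :=
    ((((I.f_int G).mul_continuousOn continuousOn_id).sub (tail_int I G)).sub
      (hD.dlam_int G)).add (hD.netOut_int G)
  refine h1.congr_uIoo ?_
  intro v hv
  rw [uIoo_of_le I.H_pos.le] at hv
  exact (f_mul_Phi D G (Ioo_subset_Icc_self hv)).symm

theorem Feasible.max_int (hD : D.Feasible I) (G : Item) :
    IntervalIntegrable (fun v => I.f G v * max 0 (D.Phi I G v)) volume 0 I.H := by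
  have h1 := hD.f_mul_Phi_int G
  rw [intervalIntegrable_iff_integrableOn_Ioo_of_le I.H_pos.le] at h1 ⊢
  refine (Integrable.pos_part h1).congr ?_
  refine (ae_restrict_mem measurableSet_Ioo).mono fun v hv => ?_
  have := (I.f_pos G v (Ioo_subset_Icc_self hv)).le
  simp only
  rw [mul_max_of_nonneg _ _ this, mul_zero, max_comm]

/-- One item's share of the Lagrangian: its revenue, plus its share of the utility of value zero,
plus the ironing and the flow terms. -/
theorem Feasible.lagrangian_item (hD : D.Feasible I) {m : Mechanism} (hm : m.Feasible I)
    (G : Item) :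
    ∫ v in (0 : ℝ)..I.H, m.a G v * (I.f G v * D.Phi I G v) =
      (∫ v in (0 : ℝ)..I.H, I.f G v * m.p G v) + -m.p Item.C 0 * I.q G
        + (∫ v in (0 : ℝ)..I.H, m.a G v * -D.dlam G v)
        + ∫ v in (0 : ℝ)..I.H, m.a G v * D.netOut I G v := by
  have hH := I.H_pos.le
  have ha := hm.monotoneOn G
  have i1 := intervalIntegrable_mul_monotoneOn hH
    ((I.f_int G).mul_continuousOn (g := fun v => v) continuousOn_id) ha
  have i2 := intervalIntegrable_mul_monotoneOn hH (tail_int I G) ha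
  have i3 : IntervalIntegrable (fun v => m.a G v * -D.dlam G v) volume 0 I.H := intervalIntegrable_mul_monotoneOn hH (hD.dlam_int G).neg ha
  have i4 := intervalIntegrable_mul_monotoneOn hH (hD.netOut_int G) ha
  have h0 : (0 : ℝ) ∈ Icc 0 I.H := left_mem_Icc.2 hH
  have hHH : I.H ∈ Icc 0 I.H := right_mem_Icc.2 hH
  have i5 : IntervalIntegrable (fun v => I.f G v * m.u G v) volume 0 I.H :=
    (I.f_int G).mul_continuousOn (intervalIntegral.continuousOn_primitive_interval'
      (monotoneOn_intervalIntegrable ha h0 hHH) left_mem_uIcc)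
  have fub := integral_mul_primitive (μ := volume) (monotoneOn_intervalIntegrable ha h0 hHH) hH
    ((intervalIntegrable_iff_integrableOn_Icc_of_le hH).1 (I.f_int G))
  have fub' : ∫ v in (0 : ℝ)..I.H, I.f G v * m.u G v =
      ∫ v in (0 : ℝ)..I.H, m.a G v * (I.q G - I.F G v) := by
    rw [intervalIntegral.integral_of_le hH, ← integral_Icc_eq_integral_Ioc]
    refine fub.trans (intervalIntegral.integral_congr fun v hv => ?_)
    rw [uIcc_of_le hH] at hv
    rw [tail_eq I G hv, intervalIntegral.integral_of_le hv.2, integral_Icc_eq_integral_Ioc]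
  have e1 : ∫ v in (0 : ℝ)..I.H, m.a G v * (I.f G v * D.Phi I G v) =
      ∫ v in (0 : ℝ)..I.H, (m.a G v * (I.f G v * v) - m.a G v * (I.q G - I.F G v)
        + m.a G v * -D.dlam G v + m.a G v * D.netOut I G v) := by
    refine intervalIntegral.integral_congr fun v hv => ?_
    rw [uIcc_of_le hH] at hv
    rw [f_mul_Phi D G hv]
    ring
  have e2 : ∫ v in (0 : ℝ)..I.H, I.f G v * m.p G v =
      ∫ v in (0 : ℝ)..I.H, (m.a G v * (I.f G v * v) - I.f G v * m.u G v
        - -m.p Item.C 0 * I.f G v) := by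
    refine intervalIntegral.integral_congr fun v hv => ?_
    rw [uIcc_of_le hH] at hv
    have := hm.utility_eq G hv
    rw [show m.p G v = v * m.a G v - (-m.p Item.C 0 + m.u G v) by linarith]
    ring
  rw [e1, e2, intervalIntegral.integral_add ((i1.sub i2).add i3) i4,
    intervalIntegral.integral_add (i1.sub i2) i3, intervalIntegral.integral_sub i1 i2,
    intervalIntegral.integral_sub (i1.sub i5) ((I.f_int G).const_mul _),
    intervalIntegral.integral_sub i1 i5, fub', intervalIntegral.integral_const_mul]
  simp only [Instance.q, Instance.F]
  ring

theorem integral_real_Icc {m : Mechanism} (hm : m.Feasible I) (G : Item) (μ : Measure ℝ)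
    [IsFiniteMeasure μ] : ∫ v in (0 : ℝ)..I.H, m.a G v * μ.real (Icc v I.H) =
      ∫ v in Icc 0 I.H, m.u G v ∂μ := by
  have hH := I.H_pos.le
  have := integral_mul_primitive (μ := μ) (k := fun _ => 1) (monotoneOn_intervalIntegrable
    (hm.monotoneOn G) (left_mem_Icc.2 hH) (right_mem_Icc.2 hH)) hH (integrable_const 1)
  simp only [one_mul, integral_const, smul_eq_mul, mul_one, measureReal_restrict_apply_univ] at this
  exact this.symm

theorem u_integrableOn {m : Mechanism} (hm : m.Feasible I) (G : Item) (μ : Measure ℝ)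
    [IsFiniteMeasure μ] : IntegrableOn (m.u G) (Icc 0 I.H) μ := by
  have hH := I.H_pos.le
  have h1 : ContinuousOn (m.u G) (uIcc 0 I.H) :=
    intervalIntegral.continuousOn_primitive_interval'
      (monotoneOn_intervalIntegrable (hm.monotoneOn G) (left_mem_Icc.2 hH) (right_mem_Icc.2 hH))
      left_mem_uIcc
  rw [uIcc_of_le hH] at h1
  exact h1.integrableOn_compact isCompact_Icc

/-- The duality gap, as a sum of nonnegative terms, one for each complementary slackness
condition. -/
theorem Feasible.value_sub_revenue (hD : D.Feasible I) {m : Mechanism} (hm : m.Feasible I) :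
    D.value I - m.revenue I = -m.p Item.C 0
      + ∑ G, (∫ v in (0 : ℝ)..I.H, I.f G v * (max 0 (D.Phi I G v) - m.a G v * D.Phi I G v))
      + ∑ G, (∫ v in (0 : ℝ)..I.H, m.a G v * -D.dlam G v)
      + (∫ v in Icc 0 I.H, (m.u Item.C v - m.u Item.A v) ∂D.alphaCA)
      + ∫ v in Icc 0 I.H, (m.u Item.C v - m.u Item.B v) ∂D.alphaCB := by
  have hH := I.H_pos.le
  have := hD.finiteA
  have := hD.finiteB
  have hq : I.q Item.A + I.q Item.B + I.q Item.C = 1 := by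
    have := I.f_mass
    rwa [sum_item] at this
  have h1 : ∀ G, ∫ v in (0 : ℝ)..I.H, I.f G v * (max 0 (D.Phi I G v) - m.a G v * D.Phi I G v) =
      (∫ v in (0 : ℝ)..I.H, I.f G v * max 0 (D.Phi I G v))
        - ∫ v in (0 : ℝ)..I.H, m.a G v * (I.f G v * D.Phi I G v) := by
    intro G
    rw [← intervalIntegral.integral_sub (hD.max_int G)
      (intervalIntegrable_mul_monotoneOn hH (hD.f_mul_Phi_int G) (hm.monotoneOn G))]
    congr 1; ext v; ring
  have hA : ∫ v in (0 : ℝ)..I.H, m.a Item.A v * D.netOut I Item.A v =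
      -∫ v in Icc 0 I.H, m.u Item.A v ∂D.alphaCA := by
    simp only [netOut, mul_neg, intervalIntegral.integral_neg, integral_real_Icc hm]
  have hB : ∫ v in (0 : ℝ)..I.H, m.a Item.B v * D.netOut I Item.B v =
      -∫ v in Icc 0 I.H, m.u Item.B v ∂D.alphaCB := by
    simp only [netOut, mul_neg, intervalIntegral.integral_neg, integral_real_Icc hm]
  have hC : ∫ v in (0 : ℝ)..I.H, m.a Item.C v * D.netOut I Item.C v =
      (∫ v in Icc 0 I.H, m.u Item.C v ∂D.alphaCA) +
        ∫ v in Icc 0 I.H, m.u Item.C v ∂D.alphaCB := by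
    simp only [netOut, mul_add]
    rw [intervalIntegral.integral_add, integral_real_Icc hm, integral_real_Icc hm]
    · exact intervalIntegrable_mul_monotoneOn hH
        (antitone_real_Icc D.alphaCA I.H).intervalIntegrable (hm.monotoneOn _)
    · exact intervalIntegrable_mul_monotoneOn hH
        (antitone_real_Icc D.alphaCB I.H).intervalIntegrable (hm.monotoneOn _)
  have sA : ∫ v in Icc 0 I.H, (m.u Item.C v - m.u Item.A v) ∂D.alphaCA =
      (∫ v in Icc 0 I.H, m.u Item.C v ∂D.alphaCA) - ∫ v in Icc 0 I.H, m.u Item.A v ∂D.alphaCA :=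
    integral_sub (u_integrableOn hm _ _) (u_integrableOn hm _ _)
  have sB : ∫ v in Icc 0 I.H, (m.u Item.C v - m.u Item.B v) ∂D.alphaCB =
      (∫ v in Icc 0 I.H, m.u Item.C v ∂D.alphaCB) - ∫ v in Icc 0 I.H, m.u Item.B v ∂D.alphaCB :=
    integral_sub (u_integrableOn hm _ _) (u_integrableOn hm _ _)
  have lA := hD.lagrangian_item hm Item.A
  have lB := hD.lagrangian_item hm Item.B
  have lC := hD.lagrangian_item hm Item.C
  simp only [h1, value, Mechanism.revenue, sum_item, sA, sB]
  rw [hA] at lA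
  rw [hB] at lB
  rw [hC] at lC
  linear_combination lA + lB + lC - m.p Item.C 0 * hq

end Dual

/-! ### Complementary slackness and optimality -/

namespace Dual

variable {D : Dual} {I : Instance} {m : Mechanism}

theorem Feasible.lam_continuousOn (hD : D.Feasible I) (G : Item) :
    ContinuousOn (D.lam G) (Icc 0 I.H) := by
  have h1 : ContinuousOn (fun v => ∫ w in I.H..v, D.dlam G w) (uIcc 0 I.H) :=
    intervalIntegral.continuousOn_primitive_interval' (hD.dlam_int G) right_mem_uIcc
  rw [uIcc_of_le I.H_pos.le] at h1
  refine h1.congr fun v hv => ?_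
  rw [hD.lam_eq G v hv, intervalIntegral.integral_symm, neg_neg]

theorem Feasible.lam_H (hD : D.Feasible I) (G : Item) : D.lam G I.H = 0 := by
  rw [hD.lam_eq G _ (right_mem_Icc.2 I.H_pos.le)]; simp

/-- A point where `λ_G` is positive has a neighbourhood on which it is. -/
theorem Feasible.exists_lam_pos (hD : D.Feasible I) {G : Item} (h0 : D.lam G 0 = 0) {v : ℝ}
    (hv : v ∈ Icc 0 I.H) (hpos : 0 < D.lam G v) :
    ∃ ε > 0, ∀ w, |w - v| ≤ ε → w ∈ Icc 0 I.H ∧ 0 < D.lam G w := by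
  have hv0 : 0 < v := by
    rcases hv.1.eq_or_lt with h | h
    · rw [← h, h0] at hpos; exact absurd hpos (lt_irrefl _)
    · exact h
  have hvH : v < I.H := by
    rcases hv.2.eq_or_lt with h | h
    · rw [h, hD.lam_H] at hpos; exact absurd hpos (lt_irrefl _)
    · exact h
  have hn : Icc 0 I.H ∈ nhds v := Icc_mem_nhds hv0 hvH
  have hc : ContinuousAt (D.lam G) v := (hD.lam_continuousOn G).continuousAt hn
  have := (hc.eventually (lt_mem_nhds hpos)).and (Filter.eventually_of_mem hn fun _ h => h)
  obtain ⟨ε, hε, h⟩ := Metric.eventually_nhds_iff_ball.1 this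
  refine ⟨ε / 2, by positivity, fun w hw => ?_⟩
  have := h w (by rw [Metric.mem_ball, Real.dist_eq]; linarith)
  exact ⟨this.2, this.1⟩

theorem CompSlack.eq_of_lam_pos (h : D.CompSlack I m) {G : Item} {x y : ℝ} (hx : x ∈ Icc 0 I.H)
    (hy : y ∈ Icc 0 I.H) (hxy : x ≤ y) (hpos : ∀ v ∈ Icc x y, 0 < D.lam G v) :
    m.a G x = m.a G y := by
  have hsub : Icc x y ⊆ Icc 0 I.H := Icc_subset_Icc hx.1 hy.2
  have := Convex.norm_image_sub_le_of_norm_hasDerivWithin_le (f := m.a G) (f' := fun _ => 0)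
    (C := 0) (s := Icc x y) (fun v hv => (h.ironed G v (hsub hv) (hpos v hv)).mono hsub)
    (fun _ _ => by simp) (convex_Icc x y) (left_mem_Icc.2 hxy) (right_mem_Icc.2 hxy)
  rw [zero_mul, norm_le_zero_iff, sub_eq_zero] at this
  exact this.symm

/-- The ironing term is the mean of `λ_G` over the points where the allocation crosses the levels. -/
theorem Feasible.ironing_layer_cake (hD : D.Feasible I) (hm : m.Feasible I) (G : Item) :
    ∃ s : ℝ → ℝ, (∀ t, s t ∈ Icc 0 I.H) ∧ (∀ t, ∀ v ∈ Icc 0 I.H, v < s t → m.a G v ≤ t) ∧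
      (∀ t, ∀ v ∈ Icc 0 I.H, s t < v → t < m.a G v) ∧
      IntegrableOn (fun t => D.lam G (s t)) (Ioc 0 1) ∧
      ∫ v in (0 : ℝ)..I.H, m.a G v * -D.dlam G v = ∫ t in Ioc (0 : ℝ) 1, D.lam G (s t) := by
  obtain ⟨s, h1, h2, h3, h4, h5⟩ := exists_layer_cake I.H_pos.le (hm.monotoneOn G) (hm.prob G)
    (hD.dlam_int G).neg
  have e : (fun t => ∫ v in s t..I.H, (-D.dlam G) v) = fun t => D.lam G (s t) := by
    ext t
    rw [hD.lam_eq G _ (h1 t), ← intervalIntegral.integral_neg]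
    rfl
  rw [e] at h4
  exact ⟨s, h1, h2, h3, h4, h5.trans (by rw [e])⟩

theorem Feasible.ironing_nonneg (hD : D.Feasible I) (hm : m.Feasible I) (G : Item) :
    0 ≤ ∫ v in (0 : ℝ)..I.H, m.a G v * -D.dlam G v := by
  obtain ⟨s, h1, -, -, -, h5⟩ := hD.ironing_layer_cake hm G
  rw [h5]
  exact integral_nonneg fun t => hD.lam_nonneg G _ (h1 t)

theorem mul_max_sub_nonneg (hm : m.Feasible I) (D : Dual) (G : Item) {v : ℝ}
    (hv : v ∈ Icc 0 I.H) : 0 ≤ I.f G v * (max 0 (D.Phi I G v) - m.a G v * D.Phi I G v) := by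
  refine mul_nonneg (I.f_pos G v hv).le ?_
  have ⟨h1, h2⟩ := hm.prob G v hv
  rcases le_total 0 (D.Phi I G v) with h | h
  · rw [max_eq_right h]; nlinarith
  · rw [max_eq_left h]; nlinarith

theorem mul_max_sub_eq_zero_iff (m : Mechanism) (D : Dual) (G : Item) {v : ℝ}
    (hv : v ∈ Icc 0 I.H) : I.f G v * (max 0 (D.Phi I G v) - m.a G v * D.Phi I G v) = 0 ↔
      (0 < D.Phi I G v → m.a G v = 1) ∧ (D.Phi I G v < 0 → m.a G v = 0) := by
  rw [mul_eq_zero, or_iff_right (I.f_pos G v hv).ne']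
  rcases lt_trichotomy (D.Phi I G v) 0 with h | h | h
  · simp [max_eq_left h.le, h, h.ne, h.not_gt]
  · simp [h]
  · rw [max_eq_right h.le]
    simp only [h, h.not_gt, forall_const, IsEmpty.forall_iff, and_true]
    constructor
    · intro h'
      have : (1 - m.a G v) * D.Phi I G v = 0 := by linarith
      rcases mul_eq_zero.1 this with h2 | h2
      · linarith
      · exact absurd h2 h.ne'
    · intro h'; rw [h']; ring

theorem Feasible.gap_int (hD : D.Feasible I) (hm : m.Feasible I) (G : Item) :
    IntervalIntegrable (fun v => I.f G v * (max 0 (D.Phi I G v) - m.a G v * D.Phi I G v))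
      volume 0 I.H := by
  have hH := I.H_pos.le
  have h2 := (hD.max_int G).sub
    (intervalIntegrable_mul_monotoneOn hH (hD.f_mul_Phi_int G) (hm.monotoneOn G))
  refine h2.congr_uIoo fun v _ => ?_
  simp only
  ring

theorem gap_nonneg (hm : m.Feasible I) (D : Dual) (G : Item) :
    0 ≤ ∫ v in (0 : ℝ)..I.H, I.f G v * (max 0 (D.Phi I G v) - m.a G v * D.Phi I G v) :=
  intervalIntegral.integral_nonneg I.H_pos.le fun _ hv => mul_max_sub_nonneg hm D G hv

theorem flow_nonneg (hm : m.Feasible I) (G : Item) (μ : Measure ℝ) :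
    0 ≤ ∫ v in Icc 0 I.H, (m.u Item.C v - m.u G v) ∂μ :=
  setIntegral_nonneg measurableSet_Icc fun _ hv => sub_nonneg.2 (hm.u_le G hv)

/-- Weak duality. -/
theorem Feasible.revenue_le_value (hD : D.Feasible I) (hm : m.Feasible I) :
    m.revenue I ≤ D.value I := by
  have h1 := hD.value_sub_revenue hm
  have h2 := Finset.sum_nonneg (s := Finset.univ) fun G _ => gap_nonneg hm D G
  have h3 := Finset.sum_nonneg (s := Finset.univ) fun G _ => hD.ironing_nonneg hm G
  have h4 := flow_nonneg hm Item.A D.alphaCA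
  have h5 := flow_nonneg hm Item.B D.alphaCB
  have h6 := hm.p_zero_nonpos
  linarith

theorem flow_ae (hm : m.Feasible I) (G : Item) (μ : Measure ℝ) [IsFiniteMeasure μ]
    (hμ : μ (Icc 0 I.H)ᶜ = 0) (h : ∫ v in Icc 0 I.H, (m.u Item.C v - m.u G v) ∂μ = 0) :
    ∀ᵐ v ∂μ, m.u Item.C v = m.u G v := by
  rw [setIntegral_eq_zero_iff_of_nonneg_ae] at h
  · rw [Filter.EventuallyEq, ae_restrict_iff' measurableSet_Icc] at h
    have hμ' : ∀ᵐ v ∂μ, v ∈ Icc 0 I.H := hμ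
    filter_upwards [h, hμ'] with v h1 h2
    have := h1 h2
    simp only [Pi.zero_apply] at this
    linarith
  · exact (ae_restrict_mem measurableSet_Icc).mono fun v hv => sub_nonneg.2 (hm.u_le G hv)
  · exact (u_integrableOn hm _ _).sub (u_integrableOn hm _ _)

/-- A feasible mechanism whose revenue attains the value of the dual satisfies complementary
slackness. The multipliers must vanish at value `0`, where an optimal allocation may be altered. -/
theorem Feasible.compSlack_of_revenue_eq (hD : D.Feasible I) (h0 : ∀ G, D.lam G 0 = 0)
    (hm : m.Feasible I) (heq : m.revenue I = D.value I) : D.CompSlack I m := by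
  have hH := I.H_pos.le
  have := hD.finiteA
  have := hD.finiteB
  have h1 := hD.value_sub_revenue hm
  have h2 := fun G => gap_nonneg hm D G
  have h3 := fun G => hD.ironing_nonneg hm G
  have h4 := flow_nonneg hm Item.A D.alphaCA
  have h5 := flow_nonneg hm Item.B D.alphaCB
  have h6 := hm.p_zero_nonpos
  have h2' := Finset.sum_nonneg (s := Finset.univ) fun G _ => h2 G
  have h3' := Finset.sum_nonneg (s := Finset.univ) fun G _ => h3 G
  have g2 : ∀ G, ∫ v in (0 : ℝ)..I.H,
      I.f G v * (max 0 (D.Phi I G v) - m.a G v * D.Phi I G v) = 0 := fun G =>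
    (Finset.sum_eq_zero_iff_of_nonneg fun G _ => h2 G).1 (by linarith) G (Finset.mem_univ G)
  have g3 : ∀ G, ∫ v in (0 : ℝ)..I.H, m.a G v * -D.dlam G v = 0 := fun G =>
    (Finset.sum_eq_zero_iff_of_nonneg fun G _ => h3 G).1 (by linarith) G (Finset.mem_univ G)
  have k2 : ∀ G, ∀ᵐ v, v ∈ Icc 0 I.H →
      (0 < D.Phi I G v → m.a G v = 1) ∧ (D.Phi I G v < 0 → m.a G v = 0) := by
    intro G
    have g := g2 G
    rw [intervalIntegral.integral_of_le hH, ← integral_Icc_eq_integral_Ioc,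
      setIntegral_eq_zero_iff_of_nonneg_ae] at g
    · rw [Filter.EventuallyEq, ae_restrict_iff' measurableSet_Icc] at g
      filter_upwards [g] with v h hv
      exact (mul_max_sub_eq_zero_iff m D G hv).1 (h hv)
    · exact (ae_restrict_mem measurableSet_Icc).mono fun v hv => mul_max_sub_nonneg hm D G hv
    · exact (intervalIntegrable_iff_integrableOn_Icc_of_le hH).1 (hD.gap_int hm G)
  refine ⟨fun G => ?_, fun G => ?_, ?_, flow_ae hm _ _ hD.suppA (by linarith),
    flow_ae hm _ _ hD.suppB (by linarith)⟩
  · filter_upwards [k2 G] with v h hv using (h hv).1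
  · filter_upwards [k2 G] with v h hv using (h hv).2
  · intro G v hv hpos
    obtain ⟨ε, hε, hnear⟩ := hD.exists_lam_pos (h0 G) hv hpos
    obtain ⟨s, hs1, hs2, hs3, hs4, hs5⟩ := hD.ironing_layer_cake hm G
    rw [g3 G, eq_comm, setIntegral_eq_zero_iff_of_nonneg_ae
      (Filter.Eventually.of_forall fun t => hD.lam_nonneg G _ (hs1 t)) hs4,
      Filter.EventuallyEq, ae_restrict_iff' measurableSet_Ioc] at hs5
    have hconst : m.a G (v - ε) = m.a G (v + ε) := by
      have m1 := (hnear (v - ε) (by rw [sub_sub_cancel_left, abs_neg, abs_of_pos hε])).1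
      have m2 := (hnear (v + ε) (by rw [add_sub_cancel_left, abs_of_pos hε])).1
      refine le_antisymm (hm.monotoneOn G m1 m2 (by linarith)) ?_
      by_contra! hlt
      -- almost every level between the two values has its threshold in the positive region
      have hne : ((volume : Measure ℝ).restrict (Ioo (m.a G (v - ε)) (m.a G (v + ε)))) ≠ 0 := by
        rw [Ne, Measure.restrict_eq_zero, Real.volume_Ioo]
        simp [hlt]
      have hex := (Filter.Eventually.and (ae_restrict_of_ae hs5)
        (ae_restrict_mem (measurableSet_Ioo (a := m.a G (v - ε)) (b := m.a G (v + ε)))))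
      obtain ⟨t, ht1, ht2⟩ := (ae_neBot.2 hne).nonempty_of_mem hex
      have ht := ht1 ⟨(hm.prob G _ m1).1.trans_lt ht2.1, ht2.2.le.trans (hm.prob G _ m2).2⟩
      have l1 : v - ε ≤ s t := by
        by_contra! hc
        exact absurd (hs3 t _ m1 hc) (not_lt.2 ht2.1.le)
      have l2 : s t ≤ v + ε := by
        by_contra! hc
        exact absurd (hs2 t _ m2 hc) (not_le.2 ht2.2)
      have := (hnear (s t) (abs_le.2 ⟨by linarith, by linarith⟩)).2
      simp only [Pi.zero_apply] at ht
      linarith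
    have hev : m.a G =ᶠ[nhds v] fun _ => m.a G v := by
      refine Filter.eventually_of_mem (Icc_mem_nhds (a := v - ε) (b := v + ε) (by linarith)
        (by linarith)) fun w hw => ?_
      have mm : ∀ w ∈ Icc (v - ε) (v + ε), m.a G w = m.a G (v - ε) := by
        intro w hw
        have m1 := (hnear (v - ε) (by rw [sub_sub_cancel_left, abs_neg, abs_of_pos hε])).1
        have m2 := (hnear (v + ε) (by rw [add_sub_cancel_left, abs_of_pos hε])).1
        have mw := (hnear w (abs_le.2 ⟨by linarith [hw.1], by linarith [hw.2]⟩)).1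
        have e1 := hm.monotoneOn G m1 mw hw.1
        have e2 := hm.monotoneOn G mw m2 hw.2
        linarith
      rw [mm w hw, mm v ⟨by linarith, by linarith⟩]
    exact ((hasDerivAt_const v (m.a G v)).congr_of_eventuallyEq hev).hasDerivWithinAt

/-- Complementary slackness closes the duality gap. -/
theorem Feasible.revenue_eq_of_compSlack (hD : D.Feasible I) (h0 : ∀ G, D.lam G 0 = 0)
    (hm : m.Feasible I) (hp : m.p Item.C 0 = 0) (h : D.CompSlack I m) :
    m.revenue I = D.value I := by
  have hH := I.H_pos.le
  have h1 := hD.value_sub_revenue hm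
  have g2 : ∀ G, ∫ v in (0 : ℝ)..I.H,
      I.f G v * (max 0 (D.Phi I G v) - m.a G v * D.Phi I G v) = 0 := by
    intro G
    rw [intervalIntegral.integral_of_le hH]
    refine setIntegral_eq_zero_of_ae_eq_zero ?_
    filter_upwards [h.pos G, h.neg G] with v hp hn hv
    have hv' := Ioc_subset_Icc_self hv
    exact (mul_max_sub_eq_zero_iff m D G hv').2 ⟨hp hv', hn hv'⟩
  have g3 : ∀ G, ∫ v in (0 : ℝ)..I.H, m.a G v * -D.dlam G v = 0 := by
    intro G
    obtain ⟨s, hs1, hs2, hs3, hs4, hs5⟩ := hD.ironing_layer_cake hm G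
    rw [hs5]
    have : ∀ t, D.lam G (s t) = 0 := by
      intro t
      by_contra hne
      have hpos := lt_of_le_of_ne (hD.lam_nonneg G _ (hs1 t)) (Ne.symm hne)
      obtain ⟨ε, hε, hnear⟩ := hD.exists_lam_pos (h0 G) (hs1 t) hpos
      have m1 := (hnear (s t - ε) (by rw [sub_sub_cancel_left, abs_neg, abs_of_pos hε])).1
      have m2 := (hnear (s t + ε) (by rw [add_sub_cancel_left, abs_of_pos hε])).1
      have e1 := hs2 t _ m1 (by linarith)
      have e2 := hs3 t _ m2 (by linarith)
      have := h.eq_of_lam_pos m1 m2 (by linarith) fun v hv =>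
        (hnear v (abs_le.2 ⟨by linarith [hv.1], by linarith [hv.2]⟩)).2
      linarith
    simp [this]
  have g4 : ∫ v in Icc 0 I.H, (m.u Item.C v - m.u Item.A v) ∂D.alphaCA = 0 := by
    refine setIntegral_eq_zero_of_ae_eq_zero ?_
    filter_upwards [h.flowA] with v hv _
    rw [hv, sub_self]
  have g5 : ∫ v in Icc 0 I.H, (m.u Item.C v - m.u Item.B v) ∂D.alphaCB = 0 := by
    refine setIntegral_eq_zero_of_ae_eq_zero ?_
    filter_upwards [h.flowB] with v hv _
    rw [hv, sub_self]
  simp only [g2, g3, g4, g5, hp, Finset.sum_const_zero] at h1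
  linarith

/-- A mechanism and a dual that satisfy complementary slackness are both optimal, and then every
optimal mechanism satisfies complementary slackness with this dual. -/
theorem Feasible.optimal_of_compSlack (hD : D.Feasible I) (h0 : ∀ G, D.lam G 0 = 0)
    (hm : m.Feasible I) (hp : m.p Item.C 0 = 0) (h : D.CompSlack I m) :
    D.Optimal I ∧ m.Optimal I ∧ ∀ m' : Mechanism, m'.Optimal I → D.CompSlack I m' := by
  have heq := hD.revenue_eq_of_compSlack h0 hm hp h
  refine ⟨⟨hD, fun D' hD' => heq ▸ hD'.revenue_le_value hm⟩,
    ⟨hm, fun m' hm' => heq ▸ hD.revenue_le_value hm'⟩, fun m' hm' => ?_⟩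
  exact hD.compSlack_of_revenue_eq h0 hm'.1
    (le_antisymm (hD.revenue_le_value hm'.1) (heq ▸ hm'.2 m hm))

end Dual

/-! ### Chains force distinct menu entries -/

theorem chainItem_add_two (i : ℕ) : chainItem (i + 2) = chainItem i := by
  simp [chainItem, Nat.even_add]

namespace Dual

variable {D : Dual} {I : Instance} {m : Mechanism}

theorem lam_pos_of_ironBot_lt (hD : D.Feasible I) {G : Item} {x v : ℝ} (hx : x ∈ Icc 0 I.H)
    (h1 : D.ironBot G x < v) (h2 : v ≤ x) : v ∈ Icc 0 I.H ∧ 0 < D.lam G v := by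
  have hnn : 0 ≤ D.ironBot G x := Real.sSup_nonneg fun v hv => hv.1
  have hv : v ∈ Icc 0 I.H := ⟨by linarith, h2.trans hx.2⟩
  refine ⟨hv, (hD.lam_nonneg G v hv).lt_of_ne fun h => ?_⟩
  exact absurd (le_csSup (s := {v | 0 ≤ v ∧ v ≤ x ∧ D.lam G v = 0}) ⟨x, fun v hv => hv.2.1⟩
    ⟨hv.1, h2, h.symm⟩) (not_le.2 h1)

theorem CompSlack.eq_of_ironBot_lt (h : D.CompSlack I m) (hD : D.Feasible I) {G : Item} {x v : ℝ}
    (hx : x ∈ Icc 0 I.H) (h1 : D.ironBot G x < v) (h2 : v ≤ x) : m.a G v = m.a G x :=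
  h.eq_of_lam_pos (lam_pos_of_ironBot_lt hD hx h1 h2).1 hx h2 fun _ hw =>
    (lam_pos_of_ironBot_lt hD hx (h1.trans_le hw.1) hw.2).2

theorem flowA_eq (h : D.CompSlack I m) {x : ℝ} (hx : D.FlowIntoA x) :
    m.u Item.C x = m.u Item.A x := by
  by_contra hne
  have h1 := h.flowA
  rw [ae_iff] at h1
  exact hx.ne' (measure_mono_null (singleton_subset_iff.2 hne) h1)

theorem flowB_eq (h : D.CompSlack I m) {x : ℝ} (hx : D.FlowIntoB x) :
    m.u Item.C x = m.u Item.B x := by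
  by_contra hne
  have h1 := h.flowB
  rw [ae_iff] at h1
  exact hx.ne' (measure_mono_null (singleton_subset_iff.2 hne) h1)

theorem u_eq_of_both (h : D.CompSlack I m) {x : ℝ} (hx : D.FlowIntoA x ∧ D.FlowIntoB x)
    (i j : ℕ) : m.u (chainItem i) x = m.u (chainItem j) x := by
  have := flowA_eq h hx.1
  have := flowB_eq h hx.2
  simp only [chainItem]
  split_ifs <;> linarith

/-- If the ironed interval containing `x` starts at the bottom of the zero region, then `u_G(x)`
is that of a single step at this bottom. -/
theorem u_eq_of_ironBot_eq_rLow (h : D.CompSlack I m) (hD : D.Feasible I) (hm : m.Feasible I)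
    {G : Item} {x y : ℝ} (hx : x ∈ Icc 0 I.H) (hbot : D.ironBot G x = D.rLow I G)
    (hy : D.ironBot G x ≤ y) (hyx : y ≤ x) : m.u G y = m.a G x * (y - D.rLow I G) := by
  have hnn : 0 ≤ D.rLow I G := hbot ▸ Real.sSup_nonneg fun v hv => hv.1
  have h0 : (0 : ℝ) ∈ Icc 0 I.H := left_mem_Icc.2 I.H_pos.le
  have hr : D.rLow I G ∈ Icc 0 I.H := ⟨hnn, by linarith [hx.2]⟩
  have hy' : y ∈ Icc 0 I.H := ⟨by linarith, by linarith [hx.2]⟩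
  have e := Mechanism.u_sub_u (hm.monotoneOn G) hr hy'
  have e0 : m.u G (D.rLow I G) = 0 := by
    have : ∫ w in (0 : ℝ)..D.rLow I G, m.a G w = ∫ w in (0 : ℝ)..D.rLow I G, 0 := by
      refine intervalIntegral.integral_congr_ae ?_
      filter_upwards [h.neg G, compl_mem_ae_iff.2 (measure_singleton (D.rLow I G))] with w hw hne hmem
      rw [uIoc_of_le hnn] at hmem
      have hw' : w ∈ Icc 0 I.H := ⟨hmem.1.le, hmem.2.trans hr.2⟩
      refine hw hw' ?_
      by_contra! hc
      have hlt : w < D.rLow I G := lt_of_le_of_ne hmem.2 hne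
      exact absurd (csInf_le (s := {v | v ∈ Icc 0 I.H ∧ 0 ≤ I.f G v * D.Phi I G v})
        ⟨0, fun v hv => hv.1.1⟩ ⟨hw', mul_nonneg (I.f_pos G w hw').le hc⟩) (not_le.2 hlt)
    rw [Mechanism.u, this, intervalIntegral.integral_zero]
  have e1 : ∫ w in D.rLow I G..y, m.a G w = ∫ w in D.rLow I G..y, m.a G x := by
    rw [hbot] at hy
    refine intervalIntegral.integral_congr_Ioo_of_le hy fun w hw => ?_
    exact h.eq_of_ironBot_lt hD hx (hbot ▸ hw.1) (hw.2.le.trans hyx)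
  rw [e0, e1, intervalIntegral.integral_const, smul_eq_mul] at e
  linarith

/-- Above the zero region every buyer is served, so `u_G` is positive there. -/
theorem u_pos_of_rHigh_lt (h : D.CompSlack I m) (hm : m.Feasible I) {G : Item} {x : ℝ}
    (hx : x ∈ Icc 0 I.H) (hr : D.rHigh I G < x) : 0 < m.u G x := by
  have hnn : 0 ≤ D.rHigh I G := Real.sSup_nonneg fun v hv => hv.1.1
  have h0 : (0 : ℝ) ∈ Icc 0 I.H := left_mem_Icc.2 I.H_pos.le
  have hr' : D.rHigh I G ∈ Icc 0 I.H := ⟨hnn, by linarith [hx.2]⟩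
  have e := Mechanism.u_sub_u (hm.monotoneOn G) hr' hx
  have e1 : ∫ w in D.rHigh I G..x, m.a G w = ∫ w in D.rHigh I G..x, 1 := by
    refine intervalIntegral.integral_congr_ae ?_
    filter_upwards [h.pos G] with w hw hmem
    rw [uIoc_of_le hr.le] at hmem
    have hw' : w ∈ Icc 0 I.H := ⟨hnn.trans hmem.1.le, hmem.2.trans hx.2⟩
    refine hw hw' ?_
    by_contra! hc
    exact absurd (le_csSup (s := {v | v ∈ Icc 0 I.H ∧ I.f G v * D.Phi I G v ≤ 0})
      ⟨I.H, fun v hv => hv.1.2⟩ ⟨hw', mul_nonpos_of_nonneg_of_nonpos (I.f_pos G w hw').le hc⟩)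
      (not_le.2 hmem.1)
  have e2 : 0 ≤ m.u G (D.rHigh I G) := intervalIntegral.integral_nonneg hnn fun w hw =>
    (hm.prob G w ⟨hw.1, hw.2.trans hr'.2⟩).1
  rw [e1, intervalIntegral.integral_const, smul_eq_mul] at e
  linarith

end Dual

section Chain

variable {D : Dual} {I : Instance} {m : Mechanism} {M : ℕ} {x : ℕ → ℝ}

/-- Between consecutive chain points every item gains the utility of the item ironed there. -/
theorem IsSpanningTopChain.integral_eq (hx : IsSpanningTopChain I D M x) (hD : D.Feasible I)
    (hm : m.Feasible I) (h : D.CompSlack I m) {i : ℕ} (hi : i + 1 < M) (j : ℕ) :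
    ∫ w in x (i + 1)..x i, m.a (chainItem j) w =
      (x i - x (i + 1)) * m.a (chainItem i) (x i) := by
  have hlt := hx.step i hi
  have h1 := hx.mem i (by omega)
  have h2 := hx.mem (i + 1) hi
  rw [← Mechanism.u_sub_u (hm.monotoneOn _) h2 h1, Dual.u_eq_of_both h (hx.both i (by omega)) j i,
    Dual.u_eq_of_both h (hx.both (i + 1) hi) j i, Mechanism.u_sub_u (hm.monotoneOn _) h2 h1]
  have : ∫ w in x (i + 1)..x i, m.a (chainItem i) w =
      ∫ w in x (i + 1)..x i, m.a (chainItem i) (x i) :=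
    intervalIntegral.integral_congr_Ioo_of_le hlt.2.le fun w hw =>
      h.eq_of_ironBot_lt hD h1 (hlt.1.trans hw.1) hw.2.le
  rw [this, intervalIntegral.integral_const, smul_eq_mul]

/-- An average of a monotone function is at least its value at the left end. -/
theorem IsSpanningTopChain.a_succ_le (hx : IsSpanningTopChain I D M x) (hD : D.Feasible I)
    (hm : m.Feasible I) (h : D.CompSlack I m) {i : ℕ} (hi : i + 1 < M) :
    m.a (chainItem (i + 1)) (x (i + 1)) ≤ m.a (chainItem i) (x i) := by
  have hlt := hx.step i hi
  have h1 := (integral_mem_Icc_of_monotoneOn (hm.monotoneOn (chainItem (i + 1))) (hx.mem (i + 1) hi)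
    (hx.mem i (by omega)) hlt.2.le).1
  rw [hx.integral_eq hD hm h hi] at h1
  exact le_of_mul_le_mul_left h1 (sub_pos.2 hlt.2)

/-- A strict decrease of the allocation at one step of the chain propagates to the step above: the
item of the lower point starts the step below its average, so it has to end it above. -/
theorem IsSpanningTopChain.a_lt_of_lt (hx : IsSpanningTopChain I D M x) (hD : D.Feasible I)
    (hm : m.Feasible I) (h : D.CompSlack I m) {i : ℕ} (hi : i + 2 < M)
    (hlt : m.a (chainItem (i + 2)) (x (i + 2)) < m.a (chainItem (i + 1)) (x (i + 1))) :
    m.a (chainItem (i + 1)) (x (i + 1)) < m.a (chainItem i) (x i) := by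
  have m0 := hx.mem i (by omega)
  have m1 := hx.mem (i + 1) (by omega)
  have m2 := hx.mem (i + 2) hi
  have s0 := hx.step i (by omega)
  have s1 := hx.step (i + 1) hi
  have hmono := hm.monotoneOn (chainItem i)
  have hint := hx.integral_eq hD hm h (i := i + 1) hi i
  have e := h.eq_of_ironBot_lt hD m0 s0.1 s0.2.le
  have hcont := (h.ironed _ _ m2 (hx.ironed (i + 2) hi)).continuousWithinAt
  rw [chainItem_add_two] at hlt hcont
  obtain ⟨y, hy, hya⟩ : ∃ y ∈ Ioo (x (i + 2)) (x (i + 1)),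
      m.a (chainItem i) y < m.a (chainItem (i + 1)) (x (i + 1)) := by
    have hsub : Ioo (x (i + 2)) (x (i + 1)) ⊆ Icc 0 I.H := fun w hw =>
      ⟨m2.1.trans hw.1.le, hw.2.le.trans m1.2⟩
    have h1 := (hcont.mono hsub).eventually (gt_mem_nhds hlt)
    have : (nhdsWithin (x (i + 2)) (Ioo (x (i + 2)) (x (i + 1)))).NeBot :=
      left_nhdsWithin_Ioo_neBot s1.2
    exact ((eventually_mem_nhdsWithin).and h1).exists
  have my : y ∈ Icc 0 I.H := ⟨m2.1.trans hy.1.le, hy.2.le.trans m1.2⟩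
  by_contra! hc
  have i1 := (integral_mem_Icc_of_monotoneOn hmono m2 my hy.1.le).2
  have i2 := (integral_mem_Icc_of_monotoneOn hmono my m1 hy.2.le).2
  have := intervalIntegral.integral_add_adjacent_intervals
    (monotoneOn_intervalIntegrable hmono m2 my) (monotoneOn_intervalIntegrable hmono my m1)
  rw [e] at i2
  rw [hint] at this
  have k1 := mul_lt_mul_of_pos_left hya (sub_pos.2 hy.1)
  have k2 := mul_le_mul_of_nonneg_left hc (sub_pos.2 hy.2).le
  linarith

/-- If the average over a step is zero, so is the allocation just below its upper end, where the
item is already at its value at the chain point above. -/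
theorem IsSpanningTopChain.a_eq_zero_of_eq_zero (hx : IsSpanningTopChain I D M x)
    (hD : D.Feasible I) (hm : m.Feasible I) (h : D.CompSlack I m) {i : ℕ} (hi : i + 2 < M)
    (h0 : m.a (chainItem (i + 1)) (x (i + 1)) = 0) : m.a (chainItem i) (x i) = 0 := by
  have m0 := hx.mem i (by omega)
  have m1 := hx.mem (i + 1) (by omega)
  have m2 := hx.mem (i + 2) hi
  have s0 := hx.step i (by omega)
  have s1 := hx.step (i + 1) hi
  have hmono := hm.monotoneOn (chainItem i)
  have hint := hx.integral_eq hD hm h (i := i + 1) hi i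
  rw [h0, mul_zero] at hint
  obtain ⟨y, hy1, hy2⟩ := exists_between (max_lt s0.1 s1.2)
  have hy3 := (le_max_left _ _).trans_lt hy1
  have hy4 := (le_max_right _ _).trans_lt hy1
  have my : y ∈ Icc 0 I.H := ⟨m2.1.trans hy4.le, hy2.le.trans m1.2⟩
  have e := h.eq_of_ironBot_lt hD m0 hy3 (hy2.trans s0.2).le
  have i1 := (integral_mem_Icc_of_monotoneOn hmono m2 my hy4.le).1
  have i2 := (integral_mem_Icc_of_monotoneOn hmono my m1 hy2.le).1
  have := intervalIntegral.integral_add_adjacent_intervals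
    (monotoneOn_intervalIntegrable hmono m2 my) (monotoneOn_intervalIntegrable hmono my m1)
  have n1 := (hm.prob (chainItem i) _ m2).1
  have n2 := (hm.prob (chainItem i) _ my).1
  rw [← e]
  have k1 := mul_nonneg (sub_pos.2 hy4).le n1
  have k2 : (x (i + 1) - y) * m.a (chainItem i) y ≤ 0 := by linarith
  have k3 := nonpos_of_mul_nonpos_right k2 (sub_pos.2 hy2)
  linarith

/-- Vanishing at a chain point propagates up to the first one, where `u_A = u_B` is positive. -/
theorem IsSpanningTopChain.a_ne_zero (hx : IsSpanningTopChain I D M x)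
    (hD : D.Feasible I) (hm : m.Feasible I) (h : D.CompSlack I m) {i : ℕ} (hi : i + 1 < M) :
    m.a (chainItem i) (x i) ≠ 0 := by
  induction i with
  | zero =>
    intro h0
    have m0 := hx.mem 0 (by omega)
    have hB := Dual.u_pos_of_rHigh_lt h hm m0 hx.top
    have hAB : m.u Item.A (x 0) = m.u Item.B (x 0) :=
      (Dual.flowA_eq h (hx.both 0 (by omega)).1).symm.trans
        (Dual.flowB_eq h (hx.both 0 (by omega)).2)
    have hA := (integral_mem_Icc_of_monotoneOn (hm.monotoneOn Item.A) (left_mem_Icc.2 I.H_pos.le) m0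
      m0.1).2
    have h0' : m.a Item.A (x 0) = 0 := h0
    rw [h0', mul_zero] at hA
    have : m.u Item.A (x 0) ≤ 0 := hA
    linarith
  | succ i ih =>
    exact fun h0 => ih (by omega) (hx.a_eq_zero_of_eq_zero hD hm h hi h0)

/-- The allocations at the chain points are strictly decreasing. -/
theorem IsSpanningTopChain.a_succ_lt (hx : IsSpanningTopChain I D M x) (hD : D.Feasible I)
    (hm : m.Feasible I) (h : D.CompSlack I m) {i : ℕ} (hi : i + 1 < M) :
    m.a (chainItem (i + 1)) (x (i + 1)) < m.a (chainItem i) (x i) := by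
  obtain ⟨k, hk⟩ : ∃ k, i + 2 + k = M := ⟨M - (i + 2), by omega⟩
  induction k generalizing i with
  | zero =>
    -- with equal nonzero slopes, `u_A = u_B` at the lowest chain point makes the zero regions
    -- of the two items start at the same value
    refine lt_of_le_of_ne (hx.a_succ_le hD hm h hi) fun heq => ?_
    have s0 := hx.step i hi
    have m0 := hx.mem i (by omega)
    have m1 := hx.mem (i + 1) hi
    have b0 := hx.bottom i (by omega) (by omega)
    have b1 := hx.bottom (i + 1) hi (by omega)
    have hle : D.ironBot (chainItem (i + 1)) (x (i + 1)) ≤ x (i + 1) :=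
      Real.sSup_le (fun v hv => hv.2.1) m1.1
    have e0 := Dual.u_eq_of_ironBot_eq_rLow h hD hm m0 b0 s0.1.le s0.2.le
    have e1 := Dual.u_eq_of_ironBot_eq_rLow h hD hm m1 b1 hle le_rfl
    rw [Dual.u_eq_of_both h (hx.both (i + 1) hi) (i + 1) i, e0, heq] at e1
    have := mul_left_cancel₀ (hx.a_ne_zero hD hm h hi) e1
    have hr : D.rLow I (chainItem i) = D.rLow I (chainItem (i + 1)) := by linarith
    have hd := hx.distinct
    rcases Nat.even_or_odd i with hev | hod
    · have : ¬ Even (i + 1) := by simpa [Nat.even_add_one] using hev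
      rw [chainItem, chainItem, if_pos hev, if_neg this] at hr
      exact hd hr
    · have h1 : ¬ Even i := Nat.not_even_iff_odd.2 hod
      have h2 : Even (i + 1) := by simpa [Nat.even_add_one] using h1
      rw [chainItem, chainItem, if_neg h1, if_pos h2] at hr
      exact hd hr.symm
  | succ k ih =>
    exact hx.a_lt_of_lt hD hm h (by omega) (ih (i := i + 1) (by omega) (by omega))

theorem IsSpanningTopChain.le_menuComplexity (hx : IsSpanningTopChain I D M x)
    (hD : D.Feasible I) (hm : m.Feasible I) (h : D.CompSlack I m) :
    (M : ℕ∞) ≤ m.menuComplexity I := by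
  have hanti : ∀ i j, i < j → j < M →
      m.a (chainItem j) (x j) < m.a (chainItem i) (x i) := by
    intro i j hij
    induction j, hij using Nat.le_induction with
    | base => exact fun hj => hx.a_succ_lt hD hm h hj
    | succ j _ ih => exact fun hj => (hx.a_succ_lt hD hm h hj).trans (ih (by omega))
  let g : Fin M → Item × ℝ := fun i => (chainItem i, m.a (chainItem i) (x i))
  have hg : Function.Injective g := by
    intro i j hij
    have h2 : m.a (chainItem i) (x i) = m.a (chainItem j) (x j) := congrArg Prod.snd hij
    rcases lt_trichotomy i j with hlt | heq | hlt
    · exact absurd h2 (hanti i j hlt j.2).ne'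
    · exact heq
    · exact absurd h2 (hanti j i hlt i.2).ne
  calc (M : ℕ∞) = (univ : Set (Fin M)).encard := by simp
    _ = (g '' univ).encard := (hg.encard_image univ).symm
    _ ≤ _ := Set.encard_le_encard (by
      rintro _ ⟨i, -, rfl⟩
      exact ⟨x i, hx.mem i i.2, rfl⟩)

end Chain

/-! ### Densities with a prescribed revenue curve -/

namespace Ladder
noncomputable section

/-- Bottom end of the zero region of each item. The parity of `M` decides which of `A` and `B` is the
item of the lowest chain point `M + 1`; its zero region starts at `M - 1/2`. -/
def low (M : ℕ) : Item → ℝ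
  | Item.A => if Even M then M + 1 / 2 else M - 1 / 2
  | Item.B => if Even M then M - 1 / 2 else M + 1 / 2
  | Item.C => M - 1 / 2

/-- Top end of the zero region of each item. -/
def high (M : ℕ) : Item → ℝ
  | Item.A => 2 * M + 1 / 2
  | Item.B => 2 * M - 1 / 2
  | Item.C => 2 * M

/-- Whether the item is ironed: `1` for `A` and `B`, and `0` for `C`. -/
def ironCoeff : Item → ℝ
  | Item.C => 0
  | _ => 1

/-- Net flow out of the item at each chain point, in units of the flow along one edge. -/
def flowCoeff : Item → ℝ
  | Item.C => 2
  | _ => -1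

/-- The number of chain points that are at least `v`. -/
def count (M : ℕ) (v : ℝ) : ℝ := ∑ i ∈ Finset.range M, if v ≤ 2 * M - i then 1 else 0

/-- The primitive `∫_v^∞` of `count`. -/
def hinge (M : ℕ) (v : ℝ) : ℝ := ∑ i ∈ Finset.range M, max (2 * M - i - v) 0

/-- Projection to the zero region of `G`. -/
def clamp (M : ℕ) (G : Item) (v : ℝ) : ℝ := max (low M G) (min v (high M G))

/-- The ironing multiplier before normalization. For `A` and `B` it vanishes exactly outside the zero
region and at the points of the zero region at even distance from its ends. -/
def lam (M : ℕ) (G : Item) (v : ℝ) : ℝ :=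
  ironCoeff G * (1 - Real.cos (Real.pi * (clamp M G v - low M G)))

/-- The derivative of `lam`. -/
def dlam (M : ℕ) (G : Item) (v : ℝ) : ℝ :=
  ironCoeff G * (Real.pi * Real.sin (Real.pi * (clamp M G v - low M G)))

/-- The revenue curve `v (q_G - F_G(v))` on `[low, H]`, before normalization. The factor `30 M ^ 2`
is large enough for the resulting density to be positive (`dens_pos`). -/
def curve (M : ℕ) (G : Item) (v : ℝ) : ℝ :=
  30 * M ^ 2 * (2 * M + 1 - max v (high M G)) - flowCoeff G * hinge M v - lam M G v

/-- The derivative of `curve`. On the zero region it equals the net flow out of `G` minus `dlam`,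
which is what makes the virtual value vanish there. -/
def dcurve (M : ℕ) (G : Item) (v : ℝ) : ℝ :=
  (if high M G < v then -(30 * (M : ℝ) ^ 2) else 0) + flowCoeff G * count M v - dlam M G v

/-- The density that has the revenue curve `curve`. -/
def dens (M : ℕ) (G : Item) (v : ℝ) : ℝ := (curve M G v / v - dcurve M G v) / v

theorem low_mem {M : ℕ} (G : Item) : low M G = M - 1 / 2 ∨ low M G = M + 1 / 2 := by
  cases G
  · rw [low]
    split_ifs
    · exact Or.inr rfl
    · exact Or.inl rfl
  · rw [low]
    split_ifs
    · exact Or.inl rfl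
    · exact Or.inr rfl
  · exact Or.inl rfl

variable {M : ℕ}

theorem one_le_cast (hM : 0 < M) : (1 : ℝ) ≤ M := by exact_mod_cast hM

theorem low_pos (hM : 0 < M) (G : Item) : 0 < low M G := by
  have := one_le_cast hM
  rcases low_mem (M := M) G with h | h <;> linarith

theorem low_le (G : Item) : low M G ≤ M + 1 / 2 := by
  rcases low_mem (M := M) G with h | h <;> linarith

theorem le_high (G : Item) : 2 * M - 1 / 2 ≤ high M G := by
  cases G <;> (simp only [high]; linarith)

theorem high_le (G : Item) : high M G ≤ 2 * M + 1 / 2 := by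
  cases G <;> (simp only [high]; linarith)

/-- The zero regions of `A` and `B` consist of whole ironed intervals, each of length `2`. -/
theorem exists_high_eq (hM : 0 < M) {G : Item} (hG : G ≠ Item.C) :
    ∃ k : ℕ, high M G = low M G + 2 * k := by
  rcases Nat.even_or_odd M with hev | hod
  · obtain ⟨l, rfl⟩ := hev
    have he : Even (l + l) := ⟨l, rfl⟩
    cases G
    · refine ⟨l, ?_⟩
      simp only [low, high, if_pos he]; push_cast; ring
    · refine ⟨l, ?_⟩
      simp only [low, high, if_pos he]; push_cast; ring
    · exact absurd rfl hG
  · have hne : ¬ Even M := Nat.not_even_iff_odd.2 hod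
    obtain ⟨l, rfl⟩ := hod
    cases G
    · refine ⟨l + 1, ?_⟩
      simp only [low, high, if_neg hne]; push_cast; ring
    · refine ⟨l, ?_⟩
      simp only [low, high, if_neg hne]; push_cast; ring
    · exact absurd rfl hG

theorem low_le_high (hM : 0 < M) (G : Item) : low M G ≤ high M G := by
  have := one_le_cast hM
  by_cases hG : G = Item.C
  · subst hG; simp only [low, high]; linarith
  · obtain ⟨k, hk⟩ := exists_high_eq hM hG
    have : (0 : ℝ) ≤ k := k.cast_nonneg
    linarith

theorem high_lt (G : Item) : high M G < 2 * M + 1 := by linarith [high_le (M := M) G]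

theorem clamp_of_le (hM : 0 < M) {G : Item} {v : ℝ} (hv : v ≤ low M G) :
    clamp M G v = low M G := by
  rw [clamp, min_eq_left (hv.trans (low_le_high hM G)), max_eq_left hv]

theorem clamp_of_ge (hM : 0 < M) {G : Item} {v : ℝ} (hv : high M G ≤ v) :
    clamp M G v = high M G := by
  rw [clamp, min_eq_right hv, max_eq_right (low_le_high hM G)]

theorem clamp_of_mem {G : Item} {v : ℝ} (hv : v ∈ Icc (low M G) (high M G)) :
    clamp M G v = v := by
  rw [clamp, min_eq_left hv.2, max_eq_right hv.1]

theorem lam_nonneg (G : Item) (v : ℝ) : 0 ≤ lam M G v := by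
  have : 0 ≤ ironCoeff G := by cases G <;> simp [ironCoeff]
  exact mul_nonneg this (sub_nonneg.2 (Real.cos_le_one _))

theorem lam_le_two (G : Item) (v : ℝ) : lam M G v ≤ 2 := by
  have h1 := Real.neg_one_le_cos (Real.pi * (clamp M G v - low M G))
  cases G <;> simp only [lam, ironCoeff] <;> linarith

theorem lam_of_le (hM : 0 < M) {G : Item} {v : ℝ} (hv : v ≤ low M G) : lam M G v = 0 := by
  simp [lam, clamp_of_le hM hv]

theorem lam_of_ge (hM : 0 < M) {G : Item} {v : ℝ} (hv : high M G ≤ v) : lam M G v = 0 := by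
  by_cases hG : G = Item.C
  · simp [lam, hG, ironCoeff]
  · obtain ⟨k, hk⟩ := exists_high_eq hM hG
    rw [lam, clamp_of_ge hM hv, hk, add_sub_cancel_left,
      show Real.pi * (2 * (k : ℝ)) = k * (2 * Real.pi) by ring, Real.cos_nat_mul_two_pi]
    simp

theorem dlam_of_le (hM : 0 < M) {G : Item} {v : ℝ} (hv : v ≤ low M G) : dlam M G v = 0 := by
  simp [dlam, clamp_of_le hM hv]

theorem dlam_of_ge (hM : 0 < M) {G : Item} {v : ℝ} (hv : high M G ≤ v) : dlam M G v = 0 := by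
  by_cases hG : G = Item.C
  · simp [dlam, hG, ironCoeff]
  · obtain ⟨k, hk⟩ := exists_high_eq hM hG
    rw [dlam, clamp_of_ge hM hv, hk, add_sub_cancel_left,
      show Real.pi * (2 * (k : ℝ)) = (2 * k : ℕ) * Real.pi by push_cast; ring,
      Real.sin_nat_mul_pi]
    simp

theorem abs_dlam_le (G : Item) (v : ℝ) : |dlam M G v| ≤ 4 := by
  have h1 := Real.abs_sin_le_one (Real.pi * (clamp M G v - low M G))
  have h2 := Real.pi_pos
  have h3 := Real.pi_le_four
  have h4 : |ironCoeff G| ≤ 1 := by cases G <;> simp [ironCoeff]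
  rw [dlam, abs_mul, abs_mul, abs_of_pos h2]
  calc _ ≤ 1 * (Real.pi * 1) := by gcongr
    _ ≤ 4 := by linarith

theorem continuous_clamp (G : Item) : Continuous (clamp M G) := by
  unfold clamp; fun_prop

theorem continuous_lam (G : Item) : Continuous (lam M G) := by
  have := continuous_clamp (M := M) G
  unfold lam; fun_prop

theorem continuous_dlam (G : Item) : Continuous (dlam M G) := by
  have := continuous_clamp (M := M) G
  unfold dlam; fun_prop

theorem hasDerivAt_lam (hM : 0 < M) {G : Item} {v : ℝ} (h1 : v ≠ low M G) (h2 : v ≠ high M G) :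
    HasDerivAt (lam M G) (dlam M G v) v := by
  rcases lt_or_gt_of_ne h1 with hlt | hgt
  · rw [dlam_of_le hM hlt.le]
    exact (hasDerivAt_const v 0).congr_of_eventuallyEq
      ((eventually_lt_nhds hlt).mono fun w hw => lam_of_le hM hw.le)
  rcases lt_or_gt_of_ne h2 with hlt' | hgt'
  · have e : (fun w => ironCoeff G * (1 - Real.cos (Real.pi * (w - low M G)))) =ᶠ[nhds v]
        lam M G := by
      filter_upwards [eventually_lt_nhds hlt', eventually_gt_nhds hgt] with w hw1 hw2
      rw [lam, clamp_of_mem ⟨hw2.le, hw1.le⟩]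
    refine HasDerivAt.congr_of_eventuallyEq ?_ e.symm
    rw [dlam, clamp_of_mem ⟨hgt.le, hlt'.le⟩]
    have := (((((hasDerivAt_id v).sub_const (low M G)).const_mul Real.pi).cos).const_sub
      1).const_mul (ironCoeff G)
    refine HasDerivAt.congr_deriv this ?_
    simp only [id]
    ring
  · rw [dlam_of_ge hM hgt'.le]
    exact (hasDerivAt_const v 0).congr_of_eventuallyEq
      ((eventually_gt_nhds hgt').mono fun w hw => lam_of_ge hM (le_of_lt hw))

theorem antitone_count : Antitone (count M) := by
  intro v w hvw
  refine Finset.sum_le_sum fun i _ => ?_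
  split_ifs with h1 h2
  · exact le_rfl
  · exact absurd (hvw.trans h1) h2
  · exact zero_le_one
  · exact le_rfl

theorem count_nonneg (v : ℝ) : 0 ≤ count M v :=
  Finset.sum_nonneg fun _ _ => by split_ifs <;> norm_num

theorem count_le (v : ℝ) : count M v ≤ M := by
  have : count M v ≤ ∑ _i ∈ Finset.range M, (1 : ℝ) :=
    Finset.sum_le_sum fun _ _ => by split_ifs <;> norm_num
  simpa using this

theorem hinge_nonneg (v : ℝ) : 0 ≤ hinge M v := Finset.sum_nonneg fun _ _ => le_max_right _ _

theorem hinge_le {v : ℝ} (hv : 0 ≤ v) : hinge M v ≤ M * (2 * M) := by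
  have : hinge M v ≤ ∑ _i ∈ Finset.range M, (2 * M : ℝ) := by
    refine Finset.sum_le_sum fun i _ => max_le ?_ (by positivity)
    have : (0 : ℝ) ≤ i := i.cast_nonneg
    linarith
  simpa using this

theorem count_of_gt {v : ℝ} (hv : 2 * M < v) : count M v = 0 := by
  refine Finset.sum_eq_zero fun i _ => if_neg ?_
  have : (0 : ℝ) ≤ i := i.cast_nonneg
  linarith

theorem count_of_le {v : ℝ} (hv : v ≤ M + 1) : count M v = M := by
  have : count M v = ∑ _i ∈ Finset.range M, (1 : ℝ) := by
    refine Finset.sum_congr rfl fun i hi => if_pos ?_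
    have : (i : ℝ) + 1 ≤ M := by exact_mod_cast Finset.mem_range.1 hi
    linarith
  simpa using this

theorem hinge_of_ge {v : ℝ} (hv : 2 * M ≤ v) : hinge M v = 0 := by
  refine Finset.sum_eq_zero fun i _ => max_eq_right ?_
  have : (0 : ℝ) ≤ i := i.cast_nonneg
  linarith

theorem continuous_hinge : Continuous (hinge M) := by
  unfold hinge; fun_prop

theorem hasDerivAt_hinge {v : ℝ} (hv : ∀ i : ℕ, i < M → v ≠ 2 * M - i) :
    HasDerivAt (hinge M) (-count M v) v := by
  have : ∀ i ∈ Finset.range M, HasDerivAt (fun w : ℝ => max (2 * (M : ℝ) - i - w) 0)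
      (-if v ≤ 2 * M - i then 1 else 0) v := by
    intro i hi
    have hne := hv i (Finset.mem_range.1 hi)
    rcases lt_or_gt_of_ne hne with hlt | hgt
    · rw [if_pos hlt.le]
      refine ((hasDerivAt_id v).const_sub (2 * (M : ℝ) - i)).congr_of_eventuallyEq ?_
      exact (eventually_lt_nhds hlt).mono fun w hw => max_eq_left (by linarith)
    · rw [if_neg (not_le.2 hgt), neg_zero]
      refine (hasDerivAt_const v (0 : ℝ)).congr_of_eventuallyEq ?_
      exact (eventually_gt_nhds hgt).mono fun w hw => max_eq_right (by linarith)
  have h := HasDerivAt.fun_sum this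
  rw [Finset.sum_neg_distrib] at h
  exact h

theorem continuous_curve (G : Item) : Continuous (curve M G) := by
  have := continuous_lam (M := M) G
  have := continuous_hinge (M := M)
  unfold curve; fun_prop

theorem hasDerivAt_curve (hM : 0 < M) {G : Item} {v : ℝ} (h1 : v ≠ low M G) (h2 : v ≠ high M G)
    (hv : ∀ i : ℕ, i < M → v ≠ 2 * M - i) : HasDerivAt (curve M G) (dcurve M G v) v := by
  have h3 : HasDerivAt (fun w => 30 * (M : ℝ) ^ 2 * (2 * M + 1 - max w (high M G)))
      (if high M G < v then -(30 * (M : ℝ) ^ 2) else 0) v := by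
    rcases lt_or_gt_of_ne h2 with hlt | hgt
    · rw [if_neg hlt.not_gt]
      refine (hasDerivAt_const v (30 * (M : ℝ) ^ 2 * (2 * M + 1 - high M G))).congr_of_eventuallyEq
        ((eventually_lt_nhds hlt).mono fun w hw => ?_)
      simp only
      rw [max_eq_right (le_of_lt hw)]
    · rw [if_pos hgt]
      have h4 := ((hasDerivAt_id v).const_sub (2 * (M : ℝ) + 1)).const_mul (30 * (M : ℝ) ^ 2)
      rw [mul_neg_one] at h4
      refine h4.congr_of_eventuallyEq ((eventually_gt_nhds hgt).mono fun w hw => ?_)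
      simp [max_eq_left (le_of_lt hw)]
  have h5 := (h3.sub ((hasDerivAt_hinge hv).const_mul (flowCoeff G))).sub (hasDerivAt_lam hM h1 h2)
  refine HasDerivAt.congr_deriv h5 ?_
  rw [dcurve]
  ring

theorem curve_top (hM : 0 < M) (G : Item) : curve M G (2 * M + 1) = 0 := by
  have h := (high_lt (M := M) G).le
  rw [curve, max_eq_left h, lam_of_ge hM h, hinge_of_ge (by linarith)]
  ring

theorem dens_pos (hM : 0 < M) (G : Item) {v : ℝ} (h1 : low M G ≤ v) (h2 : v ≤ 2 * M + 1) :
    0 < dens M G v := by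
  have hM' := one_le_cast hM
  have hv : 0 < v := (low_pos hM G).trans_le h1
  have hn := count_nonneg (M := M) v
  have hW := hinge_nonneg (M := M) v
  have hMM : (M : ℝ) ≤ M ^ 2 := by nlinarith
  refine div_pos ?_ hv
  rw [sub_pos, lt_div_iff₀ hv]
  rcases le_or_gt v (high M G) with hle | hgt
  · rw [curve, dcurve, max_eq_right hle, if_neg (not_lt.2 hle), zero_add]
    have hd := abs_le.1 (abs_dlam_le (M := M) G v)
    have hl := lam_le_two (M := M) G v
    have hh := high_le (M := M) G
    have hnn := mul_nonneg hn hv.le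
    have hdv : -dlam M G v * v ≤ 4 * (2 * M + 1) :=
      mul_le_mul (by linarith) h2 hv.le (by norm_num)
    have hK : 15 * (M : ℝ) ^ 2 ≤ 30 * M ^ 2 * (2 * M + 1 - high M G) := by nlinarith
    cases G
    · simp only [flowCoeff]
      nlinarith
    · simp only [flowCoeff]
      nlinarith
    · have hc := count_le (M := M) v
      have hW' := hinge_le (M := M) hv.le
      have hcv : count M v * v ≤ M * (2 * M) := mul_le_mul hc hle hv.le (by linarith)
      have e1 : lam M Item.C v = 0 := by simp [lam, ironCoeff]
      have e2 : dlam M Item.C v = 0 := by simp [dlam, ironCoeff]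
      rw [e1, e2]
      simp only [flowCoeff, high]
      nlinarith
  · rw [curve, dcurve, max_eq_left hgt.le, if_pos hgt, lam_of_ge hM hgt.le, dlam_of_ge hM hgt.le]
    have hK : 0 ≤ 30 * (M : ℝ) ^ 2 * (2 * M + 1 - v) := mul_nonneg (by positivity) (by linarith)
    have hKv : 0 < 30 * (M : ℝ) ^ 2 * v := by positivity
    have hnn := mul_nonneg hn hv.le
    cases G
    · simp only [flowCoeff]; nlinarith
    · simp only [flowCoeff]; nlinarith
    · rw [count_of_gt hgt, hinge_of_ge (M := M) hgt.le]
      nlinarith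

theorem dcurve_int (G : Item) (a b : ℝ) : IntervalIntegrable (dcurve M G) volume a b := by
  have h1 : Antitone fun v : ℝ => if high M G < v then -(30 * (M : ℝ) ^ 2) else 0 := by
    intro v w hvw
    have : (0 : ℝ) ≤ 30 * M ^ 2 := by positivity
    simp only
    split_ifs with h1 h2
    · exact le_rfl
    · linarith
    · exact absurd (‹high M G < v›.trans_le hvw) h1
    · exact le_rfl
  have h2 : IntervalIntegrable (fun v => flowCoeff G * count M v) volume a b :=
    antitone_count.intervalIntegrable.const_mul _
  exact (h1.intervalIntegrable.add h2).sub ((continuous_dlam G).intervalIntegrable _ _)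

theorem dens_int (hM : 0 < M) (G : Item) {a : ℝ} (ha : low M G ≤ a) (ha' : a ≤ 2 * M + 1) :
    IntervalIntegrable (dens M G) volume a (2 * M + 1) := by
  have hinv : ContinuousOn (fun v : ℝ => v⁻¹) (uIcc a (2 * M + 1)) := by
    refine continuousOn_inv₀.mono fun v hv => ?_
    rw [uIcc_of_le ha'] at hv
    exact ((low_pos hM G).trans_le (ha.trans hv.1)).ne'
  have h1 : IntervalIntegrable (fun v => curve M G v * v⁻¹) volume a (2 * M + 1) :=
    ((continuous_curve G).continuousOn.mul hinv).intervalIntegrable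
  exact ((h1.sub (dcurve_int G _ _)).mul_continuousOn hinv)

/-- Integrating the density recovers the revenue curve. -/
theorem integral_dens (hM : 0 < M) (G : Item) {a : ℝ} (ha : low M G ≤ a) (ha' : a ≤ 2 * M + 1) :
    ∫ v in a..(2 * M + 1), dens M G v = curve M G a / a := by
  have hpos : ∀ v, a ≤ v → 0 < v := fun v hv => (low_pos hM G).trans_le (ha.trans hv)
  have key := integral_eq_of_hasDerivAt_off_countable_of_le
    (fun v => -(curve M G v / v)) (dens M G) ha'
    (s := {low M G, high M G} ∪ (fun i : ℕ => 2 * (M : ℝ) - i) '' Iio M)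
    ((Set.toFinite _).union ((Set.finite_Iio M).image _)).countable ?_ ?_ (dens_int hM G ha ha')
  · rw [key, curve_top hM]; simp
  · exact ((continuous_curve G).continuousOn.div continuousOn_id
      fun v hv => (hpos v hv.1).ne').neg
  · rintro v ⟨hv, hs⟩
    simp only [mem_union, mem_insert_iff, mem_singleton_iff, mem_image, mem_Iio, not_or,
      not_exists, not_and] at hs
    have h := (hasDerivAt_curve hM hs.1.1 hs.1.2 fun i hi => (hs.2 i hi) ∘ Eq.symm)
    have hv0 := (hpos v hv.1.le).ne'
    have h2 := (h.div (hasDerivAt_id v) hv0).neg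
    refine HasDerivAt.congr_deriv h2 ?_
    simp only [dens, id]
    field_simp
    ring

end
end Ladder

/-! ### An instance and a dual with a chain of any length -/

namespace Ladder
noncomputable section

variable {M : ℕ}

/-- The density before normalization: `dens` on `[low, H]`, extended below as a constant. -/
def baseDens (M : ℕ) (G : Item) (v : ℝ) : ℝ := dens M G (max v (low M G))

theorem low_lt (G : Item) : low M G < 2 * M + 1 := by
  have := low_le (M := M) G
  have : (0 : ℝ) ≤ M := M.cast_nonneg
  linarith

theorem baseDens_pos (hM : 0 < M) (G : Item) {v : ℝ} (hv : v ≤ 2 * M + 1) :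
    0 < baseDens M G v :=
  dens_pos hM G (le_max_right _ _) (max_le hv (low_lt G).le)

theorem baseDens_int_low (G : Item) {a : ℝ} (ha : a ≤ low M G) :
    IntervalIntegrable (baseDens M G) volume a (low M G) := by
  refine (intervalIntegrable_const (c := dens M G (low M G))).congr_uIoo fun v hv => ?_
  rw [uIoo_of_le ha] at hv
  rw [baseDens, max_eq_right hv.2.le]

theorem baseDens_int_high (hM : 0 < M) (G : Item) {a : ℝ} (ha : low M G ≤ a)
    (ha' : a ≤ 2 * M + 1) : IntervalIntegrable (baseDens M G) volume a (2 * M + 1) := by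
  refine (dens_int hM G ha ha').congr_uIoo fun v hv => ?_
  rw [uIoo_of_le ha'] at hv
  rw [baseDens, max_eq_left (ha.trans hv.1.le)]

theorem baseDens_int (hM : 0 < M) (G : Item) :
    IntervalIntegrable (baseDens M G) volume 0 (2 * M + 1) :=
  (baseDens_int_low G (low_pos hM G).le).trans (baseDens_int_high hM G le_rfl (low_lt G).le)

theorem integral_baseDens_high (hM : 0 < M) (G : Item) {a : ℝ} (ha : low M G ≤ a)
    (ha' : a ≤ 2 * M + 1) : ∫ v in a..(2 * M + 1), baseDens M G v = curve M G a / a := by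
  rw [← integral_dens hM G ha ha']
  refine intervalIntegral.integral_congr_Ioo_of_le ha' fun v hv => ?_
  rw [baseDens, max_eq_left (ha.trans hv.1.le)]

theorem integral_baseDens_low (hM : 0 < M) (G : Item) {a : ℝ} (ha : a ≤ low M G) :
    ∫ v in a..(2 * M + 1), baseDens M G v =
      (low M G - a) * dens M G (low M G) + curve M G (low M G) / low M G := by
  rw [← intervalIntegral.integral_add_adjacent_intervals (baseDens_int_low G ha)
    (baseDens_int_high hM G le_rfl (low_lt G).le), integral_baseDens_high hM G le_rfl (low_lt G).le]
  congr 1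
  have : ∫ v in a..low M G, baseDens M G v = ∫ v in a..low M G, dens M G (low M G) := by
    refine intervalIntegral.integral_congr_Ioo_of_le ha fun v hv => ?_
    rw [baseDens, max_eq_right hv.2.le]
  rw [this, intervalIntegral.integral_const, smul_eq_mul]

/-- The total mass of `baseDens`. -/
def mass (M : ℕ) : ℝ := ∑ G, ∫ v in (0 : ℝ)..(2 * M + 1), baseDens M G v

theorem mass_pos (hM : 0 < M) : 0 < mass M := by
  refine Finset.sum_pos (fun G _ => ?_) ⟨Item.A, Finset.mem_univ _⟩
  exact intervalIntegral.intervalIntegral_pos_of_pos_on (baseDens_int hM G)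
    (fun v hv => baseDens_pos hM G hv.2.le) (by positivity)

/-- The instance with values in `[0, 2M + 1]` and density proportional to `baseDens`. -/
def inst (hM : 0 < M) : Instance where
  H := 2 * M + 1
  H_pos := by positivity
  f G v := (mass M)⁻¹ * baseDens M G v
  f_pos G v hv := mul_pos (inv_pos.2 (mass_pos hM)) (baseDens_pos hM G hv.2)
  f_int G := (baseDens_int hM G).const_mul _
  f_mass := by
    simp only [intervalIntegral.integral_const_mul, ← Finset.mul_sum]
    exact inv_mul_cancel₀ (mass_pos hM).ne'

/-- The flow along one edge: equal point masses at the chain points `2M, 2M - 1, …, M + 1`. -/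
def flow (M : ℕ) : Measure ℝ :=
  ENNReal.ofReal (mass M)⁻¹ • ∑ i ∈ Finset.range M, Measure.dirac (2 * M - i : ℝ)

/-- The dual with ironing multipliers proportional to `lam` and with flow `flow` into both items. -/
def dual (M : ℕ) : Dual where
  lam G v := (mass M)⁻¹ * lam M G v
  dlam G v := (mass M)⁻¹ * dlam M G v
  alphaCA := flow M
  alphaCB := flow M

instance : IsFiniteMeasure (flow M) := by
  refine ⟨?_⟩
  simp only [flow, Measure.smul_apply, Measure.finsetSum_apply, measure_univ, smul_eq_mul,
    Finset.sum_const, nsmul_eq_mul, mul_one]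
  exact ENNReal.mul_lt_top ENNReal.ofReal_lt_top (by simp)

theorem chain_mem {i : ℕ} (hi : i < M) : (2 * M - i : ℝ) ∈ Icc (M + 1 : ℝ) (2 * M) := by
  have h1 : (i : ℝ) + 1 ≤ M := by exact_mod_cast hi
  have h2 : (0 : ℝ) ≤ i := i.cast_nonneg
  constructor <;> linarith

theorem flow_compl : flow M (Icc (0 : ℝ) (2 * M + 1))ᶜ = 0 := by
  simp only [flow, Measure.smul_apply, Measure.finsetSum_apply, smul_eq_mul]
  rw [Finset.sum_eq_zero, mul_zero]
  intro i hi
  have := chain_mem (Finset.mem_range.1 hi)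
  have h0 : (0 : ℝ) ≤ M := M.cast_nonneg
  rw [Measure.dirac_apply' _ measurableSet_Icc.compl, indicator_of_notMem]
  rw [mem_compl_iff, not_not]
  exact ⟨by linarith [this.1], by linarith [this.2]⟩

theorem flow_singleton_pos (hM : 0 < M) {i : ℕ} (hi : i < M) :
    0 < flow M {(2 * M - i : ℝ)} := by
  simp only [flow, Measure.smul_apply, Measure.finsetSum_apply, smul_eq_mul]
  refine ENNReal.mul_pos (ENNReal.ofReal_pos.2 (inv_pos.2 (mass_pos hM))).ne' ?_
  intro h
  have h1 := (Finset.sum_eq_zero_iff.1 h) i (Finset.mem_range.2 hi)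
  simp at h1

theorem ae_flow {p : ℝ → Prop} (h : ∀ i : ℕ, i < M → p (2 * M - i)) : ∀ᵐ v ∂flow M, p v := by
  rw [ae_iff, flow, Measure.smul_apply, Measure.finsetSum_apply, Finset.sum_eq_zero, smul_zero]
  intro i hi
  rw [Measure.dirac_apply, indicator_of_notMem]
  exact fun h' => h' (h i (Finset.mem_range.1 hi))

theorem flow_real_Icc (hM : 0 < M) (v : ℝ) :
    (flow M).real (Icc v (2 * M + 1)) = (mass M)⁻¹ * count M v := by
  rw [measureReal_def, flow, Measure.smul_apply, Measure.finsetSum_apply, smul_eq_mul,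
    ENNReal.toReal_mul, ENNReal.toReal_ofReal (inv_pos.2 (mass_pos hM)).le,
    ENNReal.toReal_sum (fun i _ => measure_ne_top _ _), count]
  congr 1
  refine Finset.sum_congr rfl fun i hi => ?_
  have := chain_mem (Finset.mem_range.1 hi)
  rw [Measure.dirac_apply' _ measurableSet_Icc]
  split_ifs with h
  · rw [indicator_of_mem]
    · simp
    · exact ⟨h, by linarith [this.2]⟩
  · rw [indicator_of_notMem]
    · simp
    · exact fun h' => h h'.1

theorem netOut_eq (hM : 0 < M) (G : Item) (v : ℝ) :
    (dual M).netOut (inst hM) G v = (mass M)⁻¹ * (flowCoeff G * count M v) := by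
  have h := flow_real_Icc hM v
  cases G
  · change -(flow M).real (Icc v (2 * M + 1)) = _
    simp only [h, flowCoeff]; ring
  · change -(flow M).real (Icc v (2 * M + 1)) = _
    simp only [h, flowCoeff]; ring
  · change (flow M).real (Icc v (2 * M + 1)) + (flow M).real (Icc v (2 * M + 1)) = _
    rw [h, flowCoeff]; ring

theorem dual_feasible (hM : 0 < M) : (dual M).Feasible (inst hM) where
  dlam_int G := ((continuous_dlam G).intervalIntegrable _ _).const_mul _
  lam_eq G v hv := by
    have h := integral_eq_of_hasDerivAt_off_countable_of_le (lam M G) (dlam M G) hv.2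
      (s := {low M G, high M G}) (Set.toFinite _).countable (continuous_lam G).continuousOn
      (fun w hw => by
        have := hw.2
        simp only [mem_insert_iff, mem_singleton_iff, not_or] at this
        exact hasDerivAt_lam hM this.1 this.2)
      ((continuous_dlam G).intervalIntegrable _ _)
    change _ = -∫ w in v..(inst hM).H, (mass M)⁻¹ * dlam M G w
    rw [intervalIntegral.integral_const_mul, h]
    have : lam M G (inst hM).H = 0 := lam_of_ge hM (high_lt G).le
    rw [this]
    change (mass M)⁻¹ * lam M G v = _
    ring
  lam_nonneg G v _ := mul_nonneg (inv_pos.2 (mass_pos hM)).le (lam_nonneg G v)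
  finiteA := inferInstanceAs (IsFiniteMeasure (flow M))
  finiteB := inferInstanceAs (IsFiniteMeasure (flow M))
  suppA := flow_compl
  suppB := flow_compl

theorem f_mul_Phi_eq (hM : 0 < M) (G : Item) {v : ℝ} (hv : v ∈ Icc (0 : ℝ) (2 * M + 1)) :
    (inst hM).f G v * (dual M).Phi (inst hM) G v = (mass M)⁻¹ *
      (if v < low M G then 2 * dens M G (low M G) * (v - low M G)
        else if high M G < v then 30 * (M : ℝ) ^ 2 else 0) := by
  have hv' : v ∈ Icc 0 (inst hM).H := hv
  rw [Dual.f_mul_Phi _ G hv', Dual.tail_eq _ G hv', netOut_eq hM]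
  change (mass M)⁻¹ * baseDens M G v * v -
    (∫ w in v..(2 * M + 1), (mass M)⁻¹ * baseDens M G w) - (mass M)⁻¹ * dlam M G v + _ = _
  rw [intervalIntegral.integral_const_mul]
  suffices h : baseDens M G v * v - (∫ w in v..(2 * M + 1), baseDens M G w) - dlam M G v +
      flowCoeff G * count M v = (if v < low M G then 2 * dens M G (low M G) * (v - low M G)
        else if high M G < v then 30 * (M : ℝ) ^ 2 else 0) by
    rw [← h]; ring
  split_ifs with h1 h2
  · have hl := low_pos hM G
    have hh := low_le_high hM G
    have hM' := low_le (M := M) G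
    rw [integral_baseDens_low hM G h1.le, baseDens, max_eq_right h1.le, dlam_of_le hM h1.le,
      count_of_le (by linarith)]
    have e : dens M G (low M G) * low M G =
        curve M G (low M G) / low M G - flowCoeff G * M := by
      rw [dens, div_mul_cancel₀ _ hl.ne', dcurve, if_neg hh.not_gt, dlam_of_le hM le_rfl,
        count_of_le (by linarith)]
      ring
    linear_combination e
  · have hv0 : 0 < v := (low_pos hM G).trans_le (not_lt.1 h1)
    rw [integral_baseDens_high hM G (not_lt.1 h1) hv.2, baseDens, max_eq_left (not_lt.1 h1), dens,
      div_mul_cancel₀ _ hv0.ne', dcurve, if_pos h2]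
    ring
  · have hv0 : 0 < v := (low_pos hM G).trans_le (not_lt.1 h1)
    rw [integral_baseDens_high hM G (not_lt.1 h1) hv.2, baseDens, max_eq_left (not_lt.1 h1), dens,
      div_mul_cancel₀ _ hv0.ne', dcurve, if_neg h2]
    ring

/-- The virtual value is negative below the zero region, zero on it, and positive above it. -/
theorem Phi_sign (hM : 0 < M) (G : Item) {v : ℝ} (hv : v ∈ Icc (0 : ℝ) (2 * M + 1)) :
    ((dual M).Phi (inst hM) G v < 0 ↔ v < low M G) ∧
      (0 < (dual M).Phi (inst hM) G v ↔ high M G < v) := by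
  have hf : 0 < (inst hM).f G v := (inst hM).f_pos G v hv
  have hz := inv_pos.2 (mass_pos hM)
  have e := f_mul_Phi_eq hM G hv
  have hneg : ∀ {a b : ℝ}, 0 < a → (a * b < 0 ↔ b < 0) := fun ha => by
    rw [← not_le, ← not_le, mul_nonneg_iff_of_pos_left ha]
  rw [← mul_pos_iff_of_pos_left hf, ← hneg hf, e, hneg hz, mul_pos_iff_of_pos_left hz]
  have hd := dens_pos hM G le_rfl (low_lt G).le
  have hM' := one_le_cast hM
  have hlh := low_le_high hM G
  split_ifs with h1 h2
  · have : 2 * dens M G (low M G) * (v - low M G) < 0 :=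
      mul_neg_of_pos_of_neg (by linarith) (by linarith)
    exact ⟨iff_of_true this h1, iff_of_false this.not_gt (by linarith)⟩
  · have : 0 < 30 * (M : ℝ) ^ 2 := by positivity
    exact ⟨iff_of_false this.not_gt h1, iff_of_true this h2⟩
  · exact ⟨iff_of_false (lt_irrefl _) h1, iff_of_false (lt_irrefl _) h2⟩

theorem rLow_eq (hM : 0 < M) (G : Item) : (dual M).rLow (inst hM) G = low M G := by
  have hmem : low M G ∈ Icc (0 : ℝ) (2 * M + 1) := ⟨(low_pos hM G).le, (low_lt G).le⟩
  refine IsLeast.csInf_eq ⟨⟨hmem, ?_⟩, ?_⟩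
  · exact mul_nonneg ((inst hM).f_pos G _ hmem).le
      (not_lt.1 fun h => lt_irrefl _ ((Phi_sign hM G hmem).1.1 h))
  · rintro v ⟨hv, h⟩
    by_contra! hc
    exact absurd (mul_neg_of_pos_of_neg ((inst hM).f_pos G v hv) ((Phi_sign hM G hv).1.2 hc))
      (not_lt.2 h)

theorem rHigh_eq (hM : 0 < M) (G : Item) : (dual M).rHigh (inst hM) G = high M G := by
  have hmem : high M G ∈ Icc (0 : ℝ) (2 * M + 1) :=
    ⟨(low_pos hM G).le.trans (low_le_high hM G), (high_lt G).le⟩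
  refine IsGreatest.csSup_eq ⟨⟨hmem, ?_⟩, ?_⟩
  · exact mul_nonpos_of_nonneg_of_nonpos ((inst hM).f_pos G _ hmem).le
      (not_lt.1 fun h => lt_irrefl _ ((Phi_sign hM G hmem).2.1 h))
  · rintro v ⟨hv, h⟩
    by_contra! hc
    exact absurd (mul_pos ((inst hM).f_pos G v hv) ((Phi_sign hM G hv).2.2 hc)) (not_lt.2 h)

theorem chainItem_even {i : ℕ} (h : Even i) : chainItem i = Item.A := if_pos h

theorem chainItem_odd {i : ℕ} (h : ¬ Even i) : chainItem i = Item.B := if_neg h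

theorem chainItem_ne (i : ℕ) : chainItem i ≠ Item.C := by
  unfold chainItem; split_ifs <;> simp

/-- Each chain point lies in the ironed interval `[x - 3/2, x + 1/2]` of its item, and for the two
lowest points this is the lowest ironed interval of the item. -/
theorem exists_chain_eq {i : ℕ} (hi : i < M) : ∃ j : ℕ,
    (2 * M - i : ℝ) - 3 / 2 = low M (chainItem i) + 2 * j ∧ (M ≤ i + 2 → j = 0) := by
  by_cases hM : Even M <;> by_cases he : Even i
  · obtain ⟨a, rfl⟩ := hM
    obtain ⟨b, rfl⟩ := he
    obtain ⟨d, rfl⟩ : ∃ d, a = b + 1 + d := ⟨a - b - 1, by omega⟩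
    refine ⟨d, ?_, by omega⟩
    rw [chainItem_even ⟨b, rfl⟩, low, if_pos ⟨_, rfl⟩]
    push_cast; ring
  · obtain ⟨a, rfl⟩ := hM
    rw [chainItem_odd he]
    obtain ⟨b, rfl⟩ := Nat.not_even_iff_odd.1 he
    obtain ⟨d, rfl⟩ : ∃ d, a = b + 1 + d := ⟨a - b - 1, by omega⟩
    refine ⟨d, ?_, by omega⟩
    rw [low, if_pos ⟨_, rfl⟩]
    push_cast; ring
  · rw [chainItem_even he, low, if_neg hM]
    obtain ⟨a, rfl⟩ := Nat.not_even_iff_odd.1 hM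
    obtain ⟨b, rfl⟩ := he
    obtain ⟨d, rfl⟩ : ∃ d, a = b + d := ⟨a - b, by omega⟩
    refine ⟨d, ?_, by omega⟩
    push_cast; ring
  · rw [chainItem_odd he, low, if_neg hM]
    obtain ⟨a, rfl⟩ := Nat.not_even_iff_odd.1 hM
    obtain ⟨b, rfl⟩ := Nat.not_even_iff_odd.1 he
    obtain ⟨d, rfl⟩ : ∃ d, a = b + 1 + d := ⟨a - b - 1, by omega⟩
    refine ⟨d, ?_, by omega⟩
    push_cast; ring

theorem chain_le_high (i : ℕ) : (2 * M - i : ℝ) + 1 / 2 ≤ high M (chainItem i) := by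
  have h0 : (0 : ℝ) ≤ i := i.cast_nonneg
  by_cases he : Even i
  · rw [chainItem_even he, high]; linarith
  · rw [chainItem_odd he, high]
    have : (1 : ℝ) ≤ i := by
      have : i ≠ 0 := by rintro rfl; exact he Even.zero
      exact_mod_cast Nat.one_le_iff_ne_zero.2 this
    linarith

theorem lam_add_two_mul {G : Item} (j : ℕ) (h : low M G + 2 * j ≤ high M G) :
    lam M G (low M G + 2 * j) = 0 := by
  have h0 : (0 : ℝ) ≤ j := j.cast_nonneg
  rw [lam, clamp_of_mem ⟨by linarith, h⟩, add_sub_cancel_left,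
    show Real.pi * (2 * (j : ℝ)) = j * (2 * Real.pi) by ring, Real.cos_nat_mul_two_pi]
  simp

theorem lam_pos {G : Item} (hG : G ≠ Item.C) (j : ℕ) {v : ℝ} (h1 : low M G + 2 * j < v)
    (h2 : v < low M G + 2 * j + 2) (h3 : v ≤ high M G) : 0 < lam M G v := by
  have h0 : (0 : ℝ) ≤ j := j.cast_nonneg
  have hpi := Real.pi_pos
  have e : ironCoeff G = 1 := by
    cases G
    · rfl
    · rfl
    · exact absurd rfl hG
  rw [lam, clamp_of_mem ⟨by linarith, h3⟩, e, one_mul, sub_pos,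
    show Real.pi * (v - low M G) = Real.pi * (v - low M G - 2 * j) + j * (2 * Real.pi) by ring,
    Real.cos_add_nat_mul_two_pi]
  have hpos : 0 < Real.pi * (v - low M G - 2 * j) := mul_pos hpi (by linarith)
  refine lt_of_le_of_ne (Real.cos_le_one _) fun h => ?_
  have := (Real.cos_eq_one_iff_of_lt_of_lt (by linarith) (by nlinarith)).1 h
  linarith

theorem ironBot_eq (hM : 0 < M) {i : ℕ} (hi : i < M) :
    (dual M).ironBot (chainItem i) (2 * M - i) = (2 * M - i : ℝ) - 3 / 2 := by
  obtain ⟨j, hj, -⟩ := exists_chain_eq hi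
  have hz := inv_pos.2 (mass_pos hM)
  have hh := chain_le_high (M := M) i
  have hl := low_pos hM (chainItem i)
  have h0 : (0 : ℝ) ≤ j := j.cast_nonneg
  refine IsGreatest.csSup_eq ⟨⟨by linarith, by linarith, ?_⟩, ?_⟩
  · change (mass M)⁻¹ * lam M _ _ = 0
    rw [hj, lam_add_two_mul j (by linarith), mul_zero]
  · rintro v ⟨-, h2, h3⟩
    by_contra! hc
    have := lam_pos (chainItem_ne i) j (v := v) (by linarith) (by linarith) (by linarith)
    exact (mul_pos hz this).ne' h3

theorem isSpanningTopChain (hM : 0 < M) :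
    IsSpanningTopChain (inst hM) (dual M) M fun i => 2 * M - i := by
  have hz := inv_pos.2 (mass_pos hM)
  have hmem : ∀ i : ℕ, i < M → (2 * M - i : ℝ) ∈ Icc (0 : ℝ) (2 * M + 1) := fun i hi =>
    ⟨by linarith [(chain_mem hi).1, one_le_cast hM], by linarith [(chain_mem hi).2]⟩
  have hlow : ∀ i : ℕ, i < M → low M (chainItem i) ≤ (2 * M - i : ℝ) - 3 / 2 := by
    intro i hi
    obtain ⟨j, hj, -⟩ := exists_chain_eq hi
    have h0 : (0 : ℝ) ≤ j := j.cast_nonneg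
    linarith
  have hboth : ∀ i : ℕ, i < M → (dual M).FlowIntoA (2 * M - i) ∧ (dual M).FlowIntoB (2 * M - i) :=
    fun i hi => ⟨flow_singleton_pos hM hi, flow_singleton_pos hM hi⟩
  refine
    { mem := hmem
      zero := fun i hi => ?_
      flow := fun i hi => ?_
      ironed := fun i hi => ?_
      step := fun i hi => ?_
      length_pos := hM
      top := ?_
      both := hboth
      bottom := fun i hi hi' => ?_
      distinct := ?_ }
  · have h := Phi_sign hM (chainItem i) (hmem i hi)
    have := hlow i hi
    have := chain_le_high (M := M) i
    exact le_antisymm (not_lt.1 fun h' => absurd (h.2.1 h') (by linarith))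
      (not_lt.1 fun h' => absurd (h.1.1 h') (by linarith))
  · by_cases he : Even i
    · rw [chainItem_even he]; exact (hboth i hi).1
    · rw [chainItem_odd he]; exact (hboth i hi).2
  · obtain ⟨j, hj, -⟩ := exists_chain_eq hi
    have := chain_le_high (M := M) i
    exact mul_pos hz (lam_pos (chainItem_ne i) j (by linarith) (by linarith) (by linarith))
  · rw [ironBot_eq hM (by omega)]
    push_cast
    constructor <;> linarith
  · rw [rHigh_eq, high]
    simp
  · obtain ⟨j, hj, hj0⟩ := exists_chain_eq hi
    rw [ironBot_eq hM hi, rLow_eq, hj, hj0 hi']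
    simp
  · rw [rLow_eq, rLow_eq, low, low]
    split_ifs <;> intro h <;> linarith

end
end Ladder

/-! ### The optimal mechanism of the instance -/

namespace Ladder
noncomputable section

variable {M : ℕ}

/-- The affine function of `y` from `0` at `M + 1/2` to `1` at `2M + 1`. At a chain point `y` it is the
allocation of the item that is ironed there. -/
def rung (M : ℕ) (y : ℝ) : ℝ := (2 * y - 2 * M - 1) / (2 * M + 1)

/-- The allocation of `A` and `B`: steps of length `2` that start at the bottom of the zero region,
cut off at `0` and `1`. -/
def stairs (M : ℕ) (G : Item) (v : ℝ) : ℝ :=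
  max 0 (min 1 (rung M (low M G + 2 * ⌊(v - low M G) / 2⌋ + 3 / 2)))

/-- The allocation of `C`: it makes `u_C` the maximum of `u_A` and `u_B`. -/
def stairsC (M : ℕ) (v : ℝ) : ℝ :=
  if v < M - 1 / 2 then 0 else min 1 (rung M (max (⌊v⌋ + 1) (M + 1)))

/-- The allocation of the optimal mechanism of `inst`. -/
def alloc (M : ℕ) : Item → ℝ → ℝ
  | Item.C => stairsC M
  | G => stairs M G

/-- The optimal mechanism of `inst`: the allocation `alloc` with the payments of the envelope
formula. -/
def mech (M : ℕ) : Mechanism where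
  a := alloc M
  p G v := v * alloc M G v - ∫ w in (0 : ℝ)..v, alloc M G w

theorem alloc_eq {G : Item} (hG : G ≠ Item.C) : alloc M G = stairs M G := by
  cases G
  · rfl
  · rfl
  · exact absurd rfl hG

theorem rung_mono : Monotone (rung M) := by
  intro y z h
  unfold rung
  gcongr

theorem rung_nonneg {y : ℝ} (h : M + 1 / 2 ≤ y) : 0 ≤ rung M y :=
  div_nonneg (by linarith) (by positivity)

theorem rung_nonpos {y : ℝ} (h : y ≤ M + 1 / 2) : rung M y ≤ 0 :=
  div_nonpos_of_nonpos_of_nonneg (by linarith) (by positivity)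

theorem rung_le_one {y : ℝ} (h : y ≤ 2 * M + 1) : rung M y ≤ 1 := by
  rw [rung, div_le_one (by positivity)]; linarith

theorem one_le_rung {y : ℝ} (h : 2 * M + 1 ≤ y) : 1 ≤ rung M y := by
  rw [rung, one_le_div (by positivity)]; linarith

theorem stairs_mono (G : Item) : Monotone (stairs M G) := by
  intro v w h
  refine max_le_max le_rfl (min_le_min le_rfl (rung_mono ?_))
  have : (⌊(v - low M G) / 2⌋ : ℝ) ≤ ⌊(w - low M G) / 2⌋ := by
    exact_mod_cast Int.floor_mono (by linarith)
  linarith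

theorem stairsC_mem (v : ℝ) : stairsC M v ∈ Icc (0 : ℝ) 1 := by
  unfold stairsC
  split_ifs
  · simp
  · exact ⟨le_min zero_le_one (rung_nonneg (le_max_of_le_right (by linarith))), min_le_left _ _⟩

theorem stairsC_mono : Monotone (stairsC M) := by
  intro v w h
  by_cases hv : v < M - 1 / 2
  · have : stairsC M v = 0 := if_pos hv
    rw [this]; exact (stairsC_mem w).1
  · have hw : ¬ w < M - 1 / 2 := by linarith
    simp only [stairsC, if_neg hv, if_neg hw]
    refine min_le_min le_rfl (rung_mono (max_le_max ?_ le_rfl))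
    have : (⌊v⌋ : ℝ) ≤ ⌊w⌋ := by exact_mod_cast Int.floor_mono h
    linarith

theorem alloc_mono (G : Item) : Monotone (alloc M G) := by
  cases G
  exacts [stairs_mono _, stairs_mono _, stairsC_mono]

theorem stairs_mem (G : Item) (v : ℝ) : stairs M G v ∈ Icc (0 : ℝ) 1 :=
  ⟨le_max_left _ _, max_le zero_le_one (min_le_left _ _)⟩

theorem alloc_mem (G : Item) (v : ℝ) : alloc M G v ∈ Icc (0 : ℝ) 1 := by
  cases G
  exacts [stairs_mem _ _, stairs_mem _ _, stairsC_mem _]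

/-- The value of `stairs` on one step. -/
theorem stairs_eq (G : Item) (j : ℤ) {v : ℝ} (h1 : low M G + 2 * j ≤ v)
    (h2 : v < low M G + 2 * j + 2) :
    stairs M G v = max 0 (min 1 (rung M (low M G + 2 * j + 3 / 2))) := by
  have : ⌊(v - low M G) / 2⌋ = j := by
    rw [Int.floor_eq_iff]
    constructor <;> linarith
  rw [stairs, this]

theorem stairs_eq_rung (G : Item) (j : ℤ) {v y : ℝ} (h1 : low M G + 2 * j ≤ v)
    (h2 : v < low M G + 2 * j + 2) (hy : low M G + 2 * j + 3 / 2 = y) (hy1 : M + 1 / 2 ≤ y)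
    (hy2 : y ≤ 2 * M + 1) : stairs M G v = rung M y := by
  rw [stairs_eq G j h1 h2, hy, min_eq_right (rung_le_one hy2), max_eq_right (rung_nonneg hy1)]

theorem stairs_of_lt {G : Item} {v : ℝ} (h : v < low M G) : stairs M G v = 0 := by
  have h1 : ⌊(v - low M G) / 2⌋ < 0 := by rw [Int.floor_lt]; push_cast; linarith
  have h2 : (⌊(v - low M G) / 2⌋ : ℝ) ≤ -1 := by exact_mod_cast Int.le_sub_one_of_lt h1
  have h3 := low_le (M := M) G
  exact max_eq_left ((min_le_right _ _).trans (rung_nonpos (by linarith)))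

theorem stairs_of_ge (hM : 0 < M) {G : Item} (hG : G ≠ Item.C) {v : ℝ} (h : high M G ≤ v) :
    stairs M G v = 1 := by
  obtain ⟨k, hk⟩ := exists_high_eq hM hG
  have h1 : (k : ℤ) ≤ ⌊(v - low M G) / 2⌋ := by rw [Int.le_floor]; push_cast; linarith
  have h2 : (k : ℝ) ≤ ⌊(v - low M G) / 2⌋ := by exact_mod_cast h1
  have h3 := le_high (M := M) G
  rw [stairs, min_eq_left (one_le_rung (by linarith)), max_eq_right zero_le_one]

theorem stairsC_of_lt {v : ℝ} (h : v < M - 1 / 2) : stairsC M v = 0 := if_pos h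

theorem stairsC_of_ge {v : ℝ} (h : 2 * M ≤ v) : stairsC M v = 1 := by
  have h0 : (0 : ℝ) ≤ M := M.cast_nonneg
  have h1 : ((2 * M : ℤ) : ℝ) ≤ ⌊v⌋ := by
    exact_mod_cast Int.le_floor.2 (by push_cast; exact h)
  push_cast at h1
  rw [stairsC, if_neg (by linarith), min_eq_left (one_le_rung (le_max_of_le_left (by linarith)))]

theorem stairsC_bottom (hM : 0 < M) {v : ℝ} (h1 : M - 1 / 2 ≤ v) (h2 : v < M + 1) :
    stairsC M v = 1 / (2 * M + 1) := by
  have hM' := one_le_cast hM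
  have h3 : ⌊v⌋ < (M + 1 : ℤ) := by rw [Int.floor_lt]; push_cast; exact h2
  have h4 : (⌊v⌋ : ℝ) + 1 ≤ M + 1 := by exact_mod_cast h3
  rw [stairsC, if_neg (by linarith), max_eq_right h4, min_eq_right (rung_le_one (by linarith)),
    rung]
  congr 1; ring

theorem stairsC_middle {n : ℕ} (hn1 : M + 1 ≤ n) (hn2 : n ≤ 2 * M) {v : ℝ} (h1 : n ≤ v)
    (h2 : v < n + 1) : stairsC M v = rung M (n + 1) := by
  have hn1' : (M : ℝ) + 1 ≤ n := by exact_mod_cast hn1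
  have hn2' : (n : ℝ) ≤ 2 * M := by exact_mod_cast hn2
  have h3 : ⌊v⌋ = (n : ℤ) := by
    rw [Int.floor_eq_iff]; push_cast; exact ⟨h1, h2⟩
  rw [stairsC, if_neg (by linarith), h3, Int.cast_natCast, max_eq_left (by linarith),
    min_eq_right (rung_le_one (by linarith))]

theorem alloc_int (G : Item) (a b : ℝ) : IntervalIntegrable (alloc M G) volume a b :=
  (alloc_mono G).intervalIntegrable

theorem integral_stairs_of_const {G : Item} {a b c : ℝ} (hab : a ≤ b)
    (h : ∀ v ∈ Ioo a b, stairs M G v = c) : ∫ v in a..b, stairs M G v = (b - a) * c := by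
  rw [intervalIntegral.integral_congr_Ioo_of_le (g := fun _ => c) hab h,
    intervalIntegral.integral_const, smul_eq_mul]

theorem integral_stairs_add (G : Item) (a b c : ℝ) :
    ∫ v in a..c, stairs M G v = (∫ v in a..b, stairs M G v) + ∫ v in b..c, stairs M G v :=
  (intervalIntegral.integral_add_adjacent_intervals (stairs_mono G).intervalIntegrable
    (stairs_mono G).intervalIntegrable).symm

theorem integral_stairs_bottom (hM : 0 < M) (G : Item) :
    ∫ v in (M - 1 / 2 : ℝ)..(M + 1), stairs M G v =
      (M + 1 - (M - 1 / 2) : ℝ) * (1 / (2 * M + 1)) := by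
  have hM' := one_le_cast hM
  rcases low_mem (M := M) G with h | h
  · rw [integral_stairs_of_const (c := rung M (M + 1)) (by linarith)]
    · rw [rung]; ring
    · intro v hv
      exact stairs_eq_rung G 0 (by rw [h]; push_cast; linarith [hv.1])
        (by rw [h]; push_cast; linarith [hv.2]) (by rw [h]; push_cast; ring) (by linarith)
        (by linarith)
  · rw [integral_stairs_add G _ (M + 1 / 2),
      integral_stairs_of_const (a := M - 1 / 2) (c := 0) (by linarith),
      integral_stairs_of_const (c := rung M (M + 2)) (by linarith)]
    · rw [rung]
      field_simp
      ring
    · intro v hv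
      exact stairs_eq_rung G 0 (by rw [h]; push_cast; linarith [hv.1])
        (by rw [h]; push_cast; linarith [hv.2]) (by rw [h]; push_cast; ring) (by linarith)
        (by linarith)
    · intro v hv
      exact stairs_of_lt (by rw [h]; exact hv.2)

/-- On `[n, n + 1]` the allocation is either constant, or it jumps in the middle between the two
neighbouring rungs. -/
theorem integral_stairs_middle (G : Item) {n : ℕ} (hn1 : M + 1 ≤ n) (hn2 : n + 1 ≤ 2 * M) :
    ∫ v in (n : ℝ)..(n + 1), stairs M G v = (n + 1 - n : ℝ) * rung M (n + 1) := by
  have hn1' : (M : ℝ) + 1 ≤ n := by exact_mod_cast hn1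
  have hn2' : (n : ℝ) + 1 ≤ 2 * M := by exact_mod_cast hn2
  obtain ⟨j, hj | hj⟩ : ∃ j : ℤ, (n : ℝ) = low M G + 2 * j + 1 / 2 ∨
      (n : ℝ) = low M G + 2 * j + 3 / 2 := by
    rcases low_mem (M := M) G with h | h
    · obtain ⟨d, rfl⟩ := Nat.exists_eq_add_of_le hn1
      rcases Nat.even_or_odd d with ⟨e, rfl⟩ | ⟨e, rfl⟩
      · exact ⟨e, Or.inr (by rw [h]; push_cast; ring)⟩
      · exact ⟨e + 1, Or.inl (by rw [h]; push_cast; ring)⟩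
    · obtain ⟨d, rfl⟩ := Nat.exists_eq_add_of_le hn1
      rcases Nat.even_or_odd d with ⟨e, rfl⟩ | ⟨e, rfl⟩
      · exact ⟨e, Or.inl (by rw [h]; push_cast; ring)⟩
      · exact ⟨e, Or.inr (by rw [h]; push_cast; ring)⟩
  · refine integral_stairs_of_const (by linarith) fun v hv => ?_
    exact stairs_eq_rung G j (by linarith [hv.1]) (by linarith [hv.2]) (by linarith)
      (by linarith) (by linarith)
  · rw [integral_stairs_add G _ (n + 1 / 2),
      integral_stairs_of_const (a := n) (c := rung M n) (by linarith),
      integral_stairs_of_const (c := rung M (n + 2)) (by linarith)]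
    · simp only [rung]
      field_simp
      ring
    · intro v hv
      exact stairs_eq_rung G (j + 1) (by push_cast; linarith [hv.1])
        (by push_cast; linarith [hv.2]) (by push_cast; linarith) (by linarith) (by linarith)
    · intro v hv
      exact stairs_eq_rung G j (by linarith [hv.1]) (by linarith [hv.2]) (by linarith)
        (by linarith) (by linarith)

theorem u_eq_add (G : Item) (a b : ℝ) :
    (mech M).u G b = (mech M).u G a + ∫ v in a..b, alloc M G v :=
  (intervalIntegral.integral_add_adjacent_intervals (alloc_int G 0 a) (alloc_int G a b)).symm

/-- If `u_C` is affine on an interval, at the left end of which it agrees with `u_G`, and both gain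
the same there, then they agree at the right end, and `u_G ≤ u_C` in between by convexity. -/
theorem u_chord {G : Item} {a b c : ℝ} (hab : a ≤ b) (h0 : (mech M).u G a = (mech M).u Item.C a)
    (hC : ∀ v ∈ Ioo a b, alloc M Item.C v = c) (hG : ∫ v in a..b, alloc M G v = (b - a) * c) :
    (mech M).u G b = (mech M).u Item.C b ∧
      ∀ v ∈ Icc a b, (mech M).u G v ≤ (mech M).u Item.C v := by
  have hCint : ∀ v ∈ Icc a b, ∫ w in a..v, alloc M Item.C w = (v - a) * c := by
    intro v hv
    rw [intervalIntegral.integral_congr_Ioo_of_le (g := fun _ => c) hv.1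
      (fun w hw => hC w ⟨hw.1, hw.2.trans_le hv.2⟩), intervalIntegral.integral_const, smul_eq_mul]
  refine ⟨by rw [u_eq_add G a b, u_eq_add Item.C a b, h0, hG, hCint b ⟨hab, le_rfl⟩], ?_⟩
  intro v hv
  rw [u_eq_add G a v, u_eq_add Item.C a v, h0, hCint v hv]
  gcongr
  rcases le_total (alloc M G v) c with h | h
  · have := intervalIntegral.integral_mono_on (g := fun _ => c) hv.1 (alloc_int G a v)
      intervalIntegrable_const fun w hw => (alloc_mono G hw.2).trans h
    simpa using this
  · have h1 := intervalIntegral.integral_mono_on (f := fun _ => c) hv.2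
      intervalIntegrable_const (alloc_int G v b) fun w hw => h.trans (alloc_mono G hw.1)
    rw [intervalIntegral.integral_const, smul_eq_mul] at h1
    have h2 := intervalIntegral.integral_add_adjacent_intervals (alloc_int (M := M) G a v)
      (alloc_int G v b)
    linarith

/-- The two pieces below the lowest chain point: nothing is sold up to `M - 1/2`, and `C` is sold with
probability `1 / (2M + 1)` from there on. -/
theorem u_bottom (hM : 0 < M) {G : Item} (hG : G ≠ Item.C) :
    (∀ v ∈ Icc (0 : ℝ) (M + 1), (mech M).u G v ≤ (mech M).u Item.C v) ∧
      (mech M).u G (M + 1) = (mech M).u Item.C (M + 1) := by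
  have hM' := one_le_cast hM
  have h0 : (mech M).u G 0 = (mech M).u Item.C 0 := by simp [Mechanism.u]
  have h1 := u_chord (M := M) (b := M - 1 / 2) (c := 0) (by linarith) h0
    (fun _ hv => stairsC_of_lt hv.2) (by
      rw [alloc_eq hG, integral_stairs_of_const (by linarith)]
      intro v hv
      refine stairs_of_lt (hv.2.trans_le ?_)
      rcases low_mem (M := M) G with h | h <;> linarith)
  have h2 := u_chord (M := M) (b := M + 1) (by linarith) h1.1
    (fun _ hv => stairsC_bottom hM hv.1.le hv.2) (by
      rw [alloc_eq hG, integral_stairs_bottom hM])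
  refine ⟨fun v hv => ?_, h2.1⟩
  rcases le_total v (M - 1 / 2) with h | h
  · exact h1.2 v ⟨hv.1, h⟩
  · exact h2.2 v ⟨h, hv.2⟩

theorem u_step {G : Item} (hG : G ≠ Item.C) {n : ℕ} (hn1 : M + 1 ≤ n) (hn2 : n + 1 ≤ 2 * M)
    (h : (mech M).u G n = (mech M).u Item.C n) :
    (mech M).u G (n + 1) = (mech M).u Item.C (n + 1) ∧
      ∀ v ∈ Icc (n : ℝ) (n + 1), (mech M).u G v ≤ (mech M).u Item.C v :=
  u_chord (by linarith) h (fun _ hv => stairsC_middle hn1 (by omega) hv.1.le hv.2)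
    (by rw [alloc_eq hG, integral_stairs_middle G hn1 hn2])

theorem u_eq_of_nat (hM : 0 < M) {G : Item} (hG : G ≠ Item.C) {n : ℕ} (hn1 : M + 1 ≤ n)
    (hn2 : n ≤ 2 * M) : (mech M).u G n = (mech M).u Item.C n := by
  induction n, hn1 using Nat.le_induction with
  | base => push_cast; exact (u_bottom hM hG).2
  | succ n hn ih => push_cast; exact (u_step hG hn hn2 (ih (by omega))).1

theorem u_le (hM : 0 < M) (G : Item) {v : ℝ} (hv : 0 ≤ v) :
    (mech M).u G v ≤ (mech M).u Item.C v := by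
  by_cases hG : G = Item.C
  · rw [hG]
  rcases le_total v (M + 1) with h1 | h1
  · exact (u_bottom hM hG).1 v ⟨hv, h1⟩
  rcases lt_or_ge v (2 * M) with h2 | h2
  · have hf := Nat.floor_le hv
    have hf' := Nat.lt_floor_add_one v
    have hn1 : M + 1 ≤ ⌊v⌋₊ := Nat.le_floor (by push_cast; exact h1)
    have hn2 : ⌊v⌋₊ < 2 * M := (Nat.floor_lt hv).2 (by push_cast; exact h2)
    exact (u_step hG hn1 hn2 (u_eq_of_nat hM hG hn1 hn2.le)).2 v ⟨hf, hf'.le⟩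
  · have h := u_eq_of_nat hM hG (n := 2 * M) (by omega) le_rfl
    push_cast at h
    rw [u_eq_add G (2 * M), u_eq_add Item.C (2 * M), h]
    gcongr
    refine intervalIntegral.integral_mono_on h2 (alloc_int _ _ _) (alloc_int _ _ _) fun w hw => ?_
    rw [show alloc M Item.C w = 1 from stairsC_of_ge hw.1]
    exact (alloc_mem G w).2

theorem mech_feasible (hM : 0 < M) : (mech M).Feasible (inst hM) :=
  Mechanism.feasible_of_monotoneOn (fun G v _ => alloc_mem G v)
    (fun G => (alloc_mono G).monotoneOn _) (fun G _ hv => u_le hM G hv.1) fun _ _ => rfl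

/-- The allocation is constant near every point where the ironing multiplier is positive. -/
theorem hasDerivAt_stairs (hM : 0 < M) {G : Item} {v : ℝ} (hpos : 0 < lam M G v) :
    HasDerivAt (stairs M G) 0 v := by
  have hl : low M G < v := by
    by_contra! h
    exact hpos.ne' (lam_of_le hM h)
  have hh : v < high M G := by
    by_contra! h
    exact hpos.ne' (lam_of_ge hM h)
  have hfl : 0 ≤ ⌊(v - low M G) / 2⌋ := Int.floor_nonneg.2 (by linarith)
  obtain ⟨j, hj⟩ := Int.eq_ofNat_of_zero_le hfl
  have h1 : ((j : ℤ) : ℝ) ≤ (v - low M G) / 2 := hj ▸ Int.floor_le _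
  have h2 : (v - low M G) / 2 < ((j : ℤ) : ℝ) + 1 := hj ▸ Int.lt_floor_add_one _
  rw [Int.cast_natCast] at h1 h2
  have h1' : low M G + 2 * j < v := by
    refine lt_of_le_of_ne (by linarith) fun h => ?_
    rw [← h, lam_add_two_mul j (by linarith)] at hpos
    exact lt_irrefl _ hpos
  have hev : stairs M G =ᶠ[nhds v]
      fun _ => max 0 (min 1 (rung M (low M G + 2 * (j : ℤ) + 3 / 2))) := by
    refine Filter.eventually_of_mem (Ioo_mem_nhds h1' (b := low M G + 2 * j + 2) (by linarith))
      fun w hw => ?_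
    exact stairs_eq G j (by push_cast; exact hw.1.le) (by push_cast; exact hw.2)
  exact (hasDerivAt_const v _).congr_of_eventuallyEq hev

/-- Both flow constraints bind at the chain points. -/
theorem u_eq_of_chain (hM : 0 < M) {G : Item} (hG : G ≠ Item.C) {i : ℕ} (hi : i < M) :
    (mech M).u Item.C (2 * M - i) = (mech M).u G (2 * M - i) := by
  have e : (2 * M - i : ℝ) = (2 * M - i : ℕ) := by
    rw [Nat.cast_sub (by omega)]; push_cast; ring
  rw [e]
  exact (u_eq_of_nat hM hG (by omega) (by omega)).symm

theorem compSlack (hM : 0 < M) : (dual M).CompSlack (inst hM) (mech M) where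
  pos G := Filter.Eventually.of_forall fun _ hv hpos => by
    have h := (Phi_sign hM G hv).2.1 hpos
    by_cases hG : G = Item.C
    · subst hG
      exact stairsC_of_ge h.le
    · exact (congrFun (alloc_eq hG) _).trans (stairs_of_ge hM hG h.le)
  neg G := Filter.Eventually.of_forall fun _ hv hneg => by
    have h := (Phi_sign hM G hv).1.1 hneg
    by_cases hG : G = Item.C
    · subst hG
      exact stairsC_of_lt h
    · exact (congrFun (alloc_eq hG) _).trans (stairs_of_lt h)
  ironed G v _ hpos := by
    have hpos' : 0 < lam M G v := pos_of_mul_pos_right hpos (inv_pos.2 (mass_pos hM)).le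
    have hG : G ≠ Item.C := by
      rintro rfl
      simp [lam, ironCoeff] at hpos'
    change HasDerivWithinAt (alloc M G) 0 _ v
    rw [alloc_eq hG]
    exact (hasDerivAt_stairs hM hpos').hasDerivWithinAt
  flowA := ae_flow fun _ hi => u_eq_of_chain hM (by simp) hi
  flowB := ae_flow fun _ hi => u_eq_of_chain hM (by simp) hi

end
end Ladder

end SingleMinded

theorem theorem1 :
    (∀ (I : SingleMinded.Instance) (D : SingleMinded.Dual) (M : ℕ) (x : ℕ → ℝ)
      (m : SingleMinded.Mechanism),
      D.Feasible I → SingleMinded.IsSpanningTopChain I D M x →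
      m.Feasible I → D.CompSlack I m → (M : ℕ∞) ≤ m.menuComplexity I) ∧
    (∀ M : ℕ, 0 < M → ∃ (I : SingleMinded.Instance) (D : SingleMinded.Dual) (x : ℕ → ℝ),
      SingleMinded.IsSpanningTopChain I D M x ∧ D.Feasible I ∧ D.Optimal I ∧
      (∃ m : SingleMinded.Mechanism, m.Optimal I ∧ D.CompSlack I m) ∧
      (∀ m : SingleMinded.Mechanism, m.Optimal I → (M : ℕ∞) ≤ m.menuComplexity I)) := by
  refine ⟨fun I D M x m hD hx hm h => hx.le_menuComplexity hD hm h, fun M hM => ?_⟩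
  have hD := SingleMinded.Ladder.dual_feasible hM
  have hx := SingleMinded.Ladder.isSpanningTopChain hM
  have hcs := SingleMinded.Ladder.compSlack hM
  have hlam : ∀ G, (SingleMinded.Ladder.dual M).lam G 0 = 0 := fun G =>
    mul_eq_zero_of_right _
      (SingleMinded.Ladder.lam_of_le hM (SingleMinded.Ladder.low_pos hM G).le)
  obtain ⟨h1, h2, h3⟩ := hD.optimal_of_compSlack hlam (SingleMinded.Ladder.mech_feasible hM)
    (by simp [SingleMinded.Ladder.mech]) hcs
  exact ⟨_, _, _, hx, hD, h1, ⟨_, h2, hcs⟩, fun m hm =>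
    hx.le_menuComplexity hD hm.1 (h3 m hm)⟩
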